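/- Let $\mathbb F_q$ be a finite field, let $M\ge 2$ and $N>K\ge 0$ be integers, let $G=(\mathbf g_1,\dots,\mathbf g_N)\in\mathbb F_q^{K\times N}$ be a generator matrix of an $[N,K]$ MDS code, and put $n=N/\gcd(N,K)$. Coded PIR schemes. Let $\tilde L\ge1$ and $L=K\tilde L$. The records $W_1,\dots,W_M\in\mathbb F_q^{K\times\tilde L}$ have independent uniformly distributed entries, and server $i$ stores the row vectors $C^{(i)}_j=\mathbf g_i^{\tau}W_j\in\mathbb F_q^{1\times\tilde L}$, $1\le j\le M$. To retrieve $W_\theta$, the user computes queries $Q_\theta^{(1)},\dots,Q_\theta^{(N)}$ from $\theta$ and a private random seed $S$, which is discrete and independent of the records, and server $i$ returns an answer $A_\theta^{(i)}$, from a finite set, that is a function of $Q^{(i)}_\theta$ and $C^{(i)}=(C_1^{(i)},\dots,C_M^{(i)})$. The scheme has to be correct ($W_\theta$ is determined by all the answers, all the queries and $S$) and private (for each $i$, the joint distribution of $Q_\theta^{(i)},A_\theta^{(i)},C^{(i)}$ does not depend on $\theta$). Its rate is $L/D$ with $D=\sum_{i=1}^N H(A_\theta^{(i)})$, where $H$ is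 the entropy to base $q$ ($D$ does not depend on $\theta$). The capacity is the supremum of the rates of all such schemes, linear or not, with the given $\mathbb F_q$, $G$ and $M$ and with any $\tilde L$; a scheme is capacity-achieving if its rate equals the capacity. The scheme is linear if there are integers $\gamma_1,\dots,\gamma_N\ge 0$ such that $A_\theta^{(i)}=\sum_{j=1}^M C_j^{(i)}Q_{\theta,j}^{(i)}\in\mathbb F_q^{\gamma_i}$ for all $\theta$ and $i$, where the $Q_{\theta,j}^{(i)}\in\mathbb F_q^{\tilde L\times\gamma_i}$ are matrices determined by $\theta$ and the seed. The access number $\omega$ of a linear scheme (for a given value of the seed) is $$\omega=\max_{1\le\theta\le M}\ \sum_{i=1}^N\sum_{j=1}^M \mathrm{RN}\bigl(Q_{\theta,j}^{(i)}\bigr),$$ where $\mathrm{RN}(Q)$ is the number of nonzero rows of $Q$. Theorem. Every linear capacity-achieving scheme satisfies $\omega\ge MKn^{M-1}$, for every value of the seed that occurs with positive probability. -/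

import Mathlib

noncomputable section

universe u

/-- `G` is a generator matrix of an `[N, K]` MDS code: its `K` rows are linearly independent, and
every nonzero codeword has Hamming weight at least `N - K + 1` (the Singleton bound is met). -/
def IsMDSGenerator {F : Type u} [Field F] [DecidableEq F] {K N : ℕ}
    (G : Matrix (Fin K) (Fin N) F) : Prop :=
  LinearIndependent F G.row ∧
    ∀ u : Fin K → F, u ≠ 0 → N + 1 ≤ hammingNorm (Matrix.vecMul u G) + K

/-- Entropy, to base `b`, of a distribution on a finite set. -/
def entropyBase (b : ℝ) {α : Type*} [Fintype α] (p : PMF α) : ℝ :=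
  (∑ a, Real.negMulLog (p a).toReal) / Real.log b

/-- The query and response phases for `M` records stored on `N` servers through the code generated
by `G`, every record being a `K × cols` matrix over `F`. The user draws a private seed `s`,
independent of the records, and sends `query θ s i` to server `i`; this server, which stores `c`,
replies `ans i (query θ s i) c`. -/
structure CodedPIRProtocol (F : Type u) [Field F] {K N : ℕ} (M : ℕ)
    (G : Matrix (Fin K) (Fin N) F) where
  /-- number of columns of a record -/
  cols : ℕ
  cols_pos : 0 < cols
  /-- the values of the user's private randomness, and its distribution -/
  Seed : Type u
  seedLaw : PMF Seed
  Query : Fin N → Type u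
  query : Fin M → Seed → (i : Fin N) → Query i
  Answer : Fin N → Type u
  answerFintype : ∀ i, Fintype (Answer i)
  ans : (i : Fin N) → Query i → (Fin M → Fin cols → F) → Answer i

namespace CodedPIRProtocol

variable {F : Type u} [Field F] [Fintype F] [DecidableEq F] {K N M : ℕ}
  {G : Matrix (Fin K) (Fin N) F}

instance (P : CodedPIRProtocol F M G) (i : Fin N) : Fintype (P.Answer i) := P.answerFintype i

/-- The databases: `M` records, each of them a `K × cols` matrix. -/
abbrev Records (P : CodedPIRProtocol F M G) : Type u :=
  Fin M → Matrix (Fin K) (Fin P.cols) F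

/-- The content of server `i`: for each record `W j` the row vector `gᵢᵀ W j`, where `gᵢ` is the
`i`-th column of `G`. -/
def stored (P : CodedPIRProtocol F M G) (i : Fin N) (W : P.Records) : Fin M → Fin P.cols → F :=
  fun j => Matrix.vecMul (G.col i) (W j)

/-- The answer of server `i` when record `θ` is wanted. -/
def answer (P : CodedPIRProtocol F M G) (θ : Fin M) (i : Fin N) (W : P.Records) (s : P.Seed) :
    P.Answer i :=
  P.ans i (P.query θ s i) (P.stored i W)

/-- The joint distribution of records and seed: all symbols of all records are independent and
uniform on `F`, and the seed is independent of the records. -/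
def jointLaw (P : CodedPIRProtocol F M G) : PMF (P.Records × P.Seed) :=
  (PMF.uniformOfFintype P.Records).bind fun W => P.seedLaw.map fun s => (W, s)

/-- Correctness: the wanted record is determined by the answers, the queries and the seed. -/
def IsCorrect (P : CodedPIRProtocol F M G) : Prop :=
  ∀ θ : Fin M, ∃ dec : ((i : Fin N) → P.Answer i) → ((i : Fin N) → P.Query i) → P.Seed →
      Matrix (Fin K) (Fin P.cols) F,
    ∀ W : P.Records, ∀ s ∈ P.seedLaw.support,
      dec (fun i => P.answer θ i W s) (P.query θ s) s = W θ

/-- Privacy: what a single server holds (its query, its answer, its stored data) has a distribution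
that does not depend on the index of the wanted record. -/
def IsPrivate (P : CodedPIRProtocol F M G) : Prop :=
  ∀ (i : Fin N) (θ θ' : Fin M),
    P.jointLaw.map (fun x => (P.query θ x.2 i, P.answer θ i x.1 x.2, P.stored i x.1)) =
      P.jointLaw.map (fun x => (P.query θ' x.2 i, P.answer θ' i x.1 x.2, P.stored i x.1))

/-- The download size `D`: the sum over the servers of the entropies, to base `|F|`, of their
answers. -/
def downloadSize (P : CodedPIRProtocol F M G) (θ : Fin M) : ℝ :=
  ∑ i, entropyBase (Fintype.card F) (P.jointLaw.map fun x => P.answer θ i x.1 x.2)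

/-- The rate `L / D`, where `L = K * cols` is the number of symbols of a record. (For a private
protocol it does not depend on `θ`.) -/
def rate (P : CodedPIRProtocol F M G) (θ : Fin M) : ℝ :=
  ((K * P.cols : ℕ) : ℝ) / P.downloadSize θ

/-- A way in which the protocol is linear: answers of server `i` are vectors of length `γ i`, and
the answer is the sum over the records `j` of (stored row vector for `j`) times the query matrix
`Q θ s i j`. -/
structure Linear (P : CodedPIRProtocol F M G) where
  γ : Fin N → ℕ
  toVec : (i : Fin N) → P.Answer i ≃ (Fin (γ i) → F)
  Q : Fin M → P.Seed → (i : Fin N) → Fin M → Matrix (Fin P.cols) (Fin (γ i)) F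
  answer_eq : ∀ (θ : Fin M), ∀ s ∈ P.seedLaw.support, ∀ (i : Fin N) (W : P.Records),
    toVec i (P.answer θ i W s) = ∑ j, Matrix.vecMul (P.stored i W j) (Q θ s i j)

/-- Number of nonzero rows of a matrix. -/
def nonzeroRows {m n : ℕ} (A : Matrix (Fin m) (Fin n) F) : ℕ :=
  (Finset.univ.filter fun r => A.row r ≠ 0).card

/-- The access number, for the value `s` of the seed: the maximum over all retrieval indices of
the total number of nonzero rows in the query matrices. -/
def Linear.accessNumber {P : CodedPIRProtocol F M G} (lin : P.Linear) (s : P.Seed) : ℕ :=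
  Finset.univ.sup fun θ : Fin M => ∑ i, ∑ j, nonzeroRows (lin.Q θ s i j)

end CodedPIRProtocol

/-- A coded PIR scheme is a protocol that is correct and private. -/
structure CodedPIRScheme (F : Type u) [Field F] [Fintype F] [DecidableEq F] {K N : ℕ} (M : ℕ)
    (G : Matrix (Fin K) (Fin N) F) extends CodedPIRProtocol F M G where
  correct : toCodedPIRProtocol.IsCorrect
  priv : toCodedPIRProtocol.IsPrivate

/-- The capacity: the supremum of the rates of all (not only linear) PIR schemes. -/
def codedPIRCapacity {F : Type u} [Field F] [Fintype F] [DecidableEq F] {K N : ℕ} (M : ℕ)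
    (G : Matrix (Fin K) (Fin N) F) : ℝ :=
  sSup {r : ℝ | ∃ (P : CodedPIRScheme F M G) (θ : Fin M), r = P.rate θ}

/-- The scheme has the largest possible rate. -/
def CodedPIRScheme.CapacityAchieving {F : Type u} [Field F] [Fintype F] [DecidableEq F]
    {K N M : ℕ} {G : Matrix (Fin K) (Fin N) F} (P : CodedPIRScheme F M G) : Prop :=
  ∀ θ : Fin M, P.rate θ = codedPIRCapacity M G

end

/-! Put `ρ = K / N`, `L = K * cols` and `S t = 1 + ρ + ⋯ + ρ ^ (t - 1)`. For a set `T` of records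
let `r i T` be the rank of the map through which the answer of server `i` depends on the records in
`T` (`queryRank`).

Suppose that record `θ ∈ T` is wanted. Decodability makes the joint answers, restricted to `T`,
contain an injective image of record `θ` that meets the interference from `T \ {θ}` trivially. By
the MDS property the contents of any `K` servers are independent, so the interference has dimension
at least the sum of `r i (T \ {θ})` over any `K` servers. Averaging over such sets gives `∑ r i T ≥
L + ρ ∑ r i (T \ {θ})`, with equality only if `r i (T \ {θ})` is the same for all `i`
(`queryRank_erase_le`). After taking means over the seed, privacy allows a different wanted record
at each step, so the mean of `∑ r i T` is at least `L * S |T|`; for all records together this mean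
is at most `D`.

Conversely, an explicit cyclic scheme with long records has rates approaching `1 / S M`
(`one_le_capacity_mul_rateSum`). Hence a capacity-achieving scheme has `D ≤ L * S M`, and every
inequality above is tight for every seed of positive probability (`sum_queryRank_eq`). That this
value is also an upper bound for nonlinear schemes is never needed.

Two consequences finish the proof. For a proper subset `T`, each rank is the integer `L * S |T| /
N`; comparing `|T| = M - 1` with `|T| = M - 2` shows that `n ^ (M - 1)` divides `cols`. For `T =
{j}` the ranks add up to `L`, and a rank is at most the number of nonzero rows. So each of the `M`
records costs at least `K * cols ≥ K * n ^ (M - 1)` accesses. -/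

noncomputable section

open Real

/-! ### Entropy of distributions on finite sets -/

namespace PMF

variable {α β : Type*}

lemma sum_toReal [Fintype α] (p : PMF α) : ∑ a, (p a).toReal = 1 := by
  rw [← ENNReal.toReal_sum fun a _ => p.apply_ne_top a, ← tsum_fintype (L := .unconditional _),
    p.tsum_coe, ENNReal.toReal_one]

lemma toReal_nonneg (p : PMF α) (a : α) : 0 ≤ (p a).toReal := ENNReal.toReal_nonneg

lemma toReal_pos {p : PMF α} {a : α} (h : a ∈ p.support) : 0 < (p a).toReal :=
  ENNReal.toReal_pos h (p.apply_ne_top a)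

lemma toReal_bind [Fintype α] (p : PMF α) (k : α → PMF β) (b : β) :
    (p.bind k b).toReal = ∑ a, (p a).toReal * (k a b).toReal := by
  rw [PMF.bind_apply, tsum_fintype,
    ENNReal.toReal_sum fun a _ => ENNReal.mul_ne_top (p.apply_ne_top a) ((k a).apply_ne_top b)]
  simp

open Classical in
lemma toReal_map [Fintype α] (p : PMF α) (f : α → β) (b : β) :
    (p.map f b).toReal = ∑ a with f a = b, (p a).toReal := by
  rw [PMF.map_apply, tsum_fintype, ENNReal.toReal_sum, Finset.sum_filter]
  · refine Finset.sum_congr rfl fun a _ => ?_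
    by_cases h : f a = b
    · simp [h]
    · simp [h, Ne.symm h]
  · intro a _
    split_ifs <;> simp [p.apply_ne_top a]

lemma sum_map_mul [Fintype α] [Fintype β] (p : PMF α) (f : α → β) (g : β → ℝ) :
    ∑ b, (p.map f b).toReal * g b = ∑ a, (p a).toReal * g (f a) := by
  classical
  simp_rw [toReal_map, Finset.sum_mul]
  rw [← Finset.sum_fiberwise (s := Finset.univ) (g := f)]
  refine Finset.sum_congr rfl fun b _ => Finset.sum_congr rfl fun a ha => ?_
  rw [(Finset.mem_filter.mp ha).2]

lemma map_congr_of_support (p : PMF α) {f g : α → β} (h : ∀ a ∈ p.support, f a = g a) :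
    p.map f = p.map g := by
  ext b
  rw [PMF.map_apply, PMF.map_apply]
  refine tsum_congr fun a => ?_
  by_cases ha : a ∈ p.support
  · rw [h a ha]
  · simp [(p.apply_eq_zero_iff a).2 ha]

/-- Entropy in nats of a distribution on a finite set. -/
def entropy [Fintype α] (p : PMF α) : ℝ := ∑ a, negMulLog (p a).toReal

lemma sum_mul_negMulLog_le [Fintype α] (p : PMF α) (k : α → PMF β) (b : β) :
    ∑ a, (p a).toReal * negMulLog (k a b).toReal ≤ negMulLog (p.bind k b).toReal := by
  have := concaveOn_negMulLog.le_map_sum (t := Finset.univ) (w := fun a => (p a).toReal)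
    (p := fun a => (k a b).toReal) (fun a _ => p.toReal_nonneg a) p.sum_toReal
    (fun a _ => (k a).toReal_nonneg b)
  rw [toReal_bind]
  simpa using this

/-- Conditioning reduces entropy. -/
lemma sum_mul_entropy_le_entropy_bind [Fintype α] [Fintype β] (p : PMF α) (k : α → PMF β) :
    ∑ a, (p a).toReal * (k a).entropy ≤ (p.bind k).entropy := by
  simp_rw [entropy, Finset.mul_sum]
  rw [Finset.sum_comm]
  exact Finset.sum_le_sum fun b _ => sum_mul_negMulLog_le p k b

/-- If conditioning does not reduce the entropy, then the components of the mixture agree. -/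
lemma eq_bind_of_entropy_bind_le [Fintype α] [Fintype β] (p : PMF α) (k : α → PMF β)
    (h : (p.bind k).entropy ≤ ∑ a, (p a).toReal * (k a).entropy) {a : α} (ha : a ∈ p.support) :
    k a = p.bind k := by
  have heq : ∀ b, negMulLog (p.bind k b).toReal =
      ∑ a, (p a).toReal * negMulLog (k a b).toReal := by
    have hsum : ∑ b, ∑ a, (p a).toReal * negMulLog (k a b).toReal =
        ∑ b, negMulLog (p.bind k b).toReal := by
      refine le_antisymm (Finset.sum_le_sum fun b _ => sum_mul_negMulLog_le p k b) ?_
      rw [Finset.sum_comm]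
      simpa only [entropy, Finset.mul_sum] using h
    intro b
    exact ((Finset.sum_eq_sum_iff_of_le fun b _ => sum_mul_negMulLog_le p k b).1 hsum b
      (Finset.mem_univ b)).symm
  ext b
  have := (strictConcaveOn_negMulLog.map_sum_eq_iff' (t := Finset.univ)
    (w := fun a => (p a).toReal) (p := fun a => (k a b).toReal) (fun a _ => p.toReal_nonneg a)
    p.sum_toReal (fun a _ => (k a).toReal_nonneg b)).1
    (by have := heq b; rw [toReal_bind] at this; simpa using this) a (Finset.mem_univ a) (toReal_pos ha).ne'
  rw [← ENNReal.toReal_eq_toReal_iff' ((k a).apply_ne_top b) ((p.bind k).apply_ne_top b),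
    toReal_bind]
  simpa using this

/-- Gibbs' inequality. -/
lemma entropy_le_sum_mul_neg_log [Fintype α] (p : PMF α) (q : α → ℝ)
    (hq : ∀ a ∈ p.support, 0 < q a) (hq' : ∀ a, 0 ≤ q a) (hsum : ∑ a, q a ≤ 1) :
    p.entropy ≤ ∑ a, (p a).toReal * -log (q a) := by
  -- This is `log x ≤ x - 1` at `x = q a / p a`, multiplied by `p a`.
  have key : ∀ a, negMulLog (p a).toReal ≤ (p a).toReal * -log (q a) + (q a - (p a).toReal) := by
    intro a
    by_cases ha : a ∈ p.support
    · have hp := toReal_pos ha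
      have h1 := log_le_sub_one_of_pos (div_pos (hq a ha) hp)
      rw [log_div (hq a ha).ne' hp.ne'] at h1
      have h2 := mul_le_mul_of_nonneg_left h1 hp.le
      rw [mul_sub (p a).toReal (q a / _), mul_div_cancel₀ _ hp.ne'] at h2
      rw [negMulLog]
      linarith
    · simp [(p.apply_eq_zero_iff a).2 ha, hq' a]
  calc p.entropy ≤ ∑ a, ((p a).toReal * -log (q a) + (q a - (p a).toReal)) :=
        Finset.sum_le_sum fun a _ => key a
    _ = (∑ a, (p a).toReal * -log (q a)) + (∑ a, q a - 1) := by
        rw [Finset.sum_add_distrib, Finset.sum_sub_distrib, p.sum_toReal]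
    _ ≤ _ := by linarith

lemma entropy_le_log_card [Fintype α] (p : PMF α) (s : Finset α) (hs : ∀ a ∈ p.support, a ∈ s) :
    p.entropy ≤ log s.card := by
  classical
  obtain ⟨a₀, ha₀⟩ := p.support_nonempty
  have hc : 0 < (s.card : ℝ) := by exact_mod_cast Finset.card_pos.2 ⟨a₀, hs a₀ ha₀⟩
  refine (p.entropy_le_sum_mul_neg_log (fun a => if a ∈ s then (s.card : ℝ)⁻¹ else 0) ?_ ?_ ?_).trans
    ?_
  · intro a ha
    simp only [hs a ha, if_true]
    positivity
  · intro a
    positivity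
  · rw [Finset.sum_ite_mem, Finset.univ_inter, Finset.sum_const, nsmul_eq_mul,
      mul_inv_cancel₀ hc.ne']
  · rw [← one_mul (log s.card), ← p.sum_toReal, Finset.sum_mul]
    refine Finset.sum_le_sum fun a _ => ?_
    by_cases ha : a ∈ p.support
    · simp [hs a ha]
    · simp [(p.apply_eq_zero_iff a).2 ha]

/-- Subadditivity of entropy. -/
lemma entropy_le_sum_entropy_map {ι : Type*} [Fintype ι] [DecidableEq ι] {A : ι → Type*}
    [∀ i, Fintype (A i)] (p : PMF (∀ i, A i)) :
    p.entropy ≤ ∑ i, (p.map fun x => x i).entropy := by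
  have hpos : ∀ x ∈ p.support, ∀ i, 0 < (p.map (fun x => x i) (x i)).toReal := fun x hx i =>
    toReal_pos ((PMF.mem_support_map_iff _ _ _).2 ⟨x, hx, rfl⟩)
  -- Gibbs' inequality against the product of the marginals.
  refine (p.entropy_le_sum_mul_neg_log (fun x => ∏ i, (p.map (fun x => x i) (x i)).toReal)
    (fun x hx => Finset.prod_pos fun i _ => hpos x hx i)
    (fun x => Finset.prod_nonneg fun i _ => toReal_nonneg _ _) ?_).trans ?_
  · rw [← Fintype.piFinset_univ,
      ← Finset.prod_univ_sum (fun i => Finset.univ) fun i a => (p.map (fun x => x i) a).toReal]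
    simp only [sum_toReal, Finset.prod_const_one, le_refl]
  · have h1 : ∀ i, (p.map fun x => x i).entropy =
        ∑ x, (p x).toReal * -log (p.map (fun x => x i) (x i)).toReal := by
      intro i
      rw [← sum_map_mul p (fun x => x i) fun a => -log (p.map (fun x => x i) a).toReal]
      simp [entropy, negMulLog]
    simp_rw [h1]
    rw [Finset.sum_comm]
    refine Finset.sum_le_sum fun x _ => ?_
    rw [← Finset.mul_sum]
    by_cases hx : x ∈ p.support
    · rw [log_prod fun i _ => (hpos x hx i).ne', Finset.sum_neg_distrib]
    · simp [(p.apply_eq_zero_iff x).2 hx]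

lemma entropy_map_le [Fintype α] [Fintype β] (p : PMF α) (f : α → β) :
    (p.map f).entropy ≤ p.entropy := by
  classical
  have h1 : (p.map f).entropy = ∑ a, (p a).toReal * -log (p.map f (f a)).toReal := by
    rw [← sum_map_mul p f fun b => -log (p.map f b).toReal]
    simp [entropy, negMulLog]
  rw [h1, entropy]
  refine Finset.sum_le_sum fun a _ => ?_
  by_cases ha : a ∈ p.support
  · have hp := toReal_pos ha
    have hle : (p a).toReal ≤ (p.map f (f a)).toReal := by
      rw [toReal_map]
      exact Finset.single_le_sum (f := fun a => (p a).toReal) (fun a _ => p.toReal_nonneg a)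
        (by simp)
    have := mul_le_mul_of_nonneg_left (log_le_log hp hle) hp.le
    rw [negMulLog]
    linarith
  · simp [(p.apply_eq_zero_iff a).2 ha]

/-- The entropy of a mixture is at most that of the mixing distribution plus the mean entropy of
the components. -/
lemma entropy_bind_le [Fintype α] [Fintype β] (p : PMF α) (k : α → PMF β) :
    (p.bind k).entropy ≤ p.entropy + ∑ a, (p a).toReal * (k a).entropy := by
  have key : ∀ a b, ((p a).toReal * (k a b).toReal) * -log (p.bind k b).toReal ≤
      (k a b).toReal * negMulLog (p a).toReal + (p a).toReal * negMulLog (k a b).toReal := by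
    intro a b
    rw [← negMulLog_mul, negMulLog]
    rcases (mul_nonneg (p.toReal_nonneg a) ((k a).toReal_nonneg b)).eq_or_lt with h | h
    · simp [← h]
    · have hle : (p a).toReal * (k a b).toReal ≤ (p.bind k b).toReal := by
        rw [toReal_bind]
        exact Finset.single_le_sum (f := fun a => (p a).toReal * (k a b).toReal)
          (fun a _ => mul_nonneg (p.toReal_nonneg a) ((k a).toReal_nonneg b)) (Finset.mem_univ a)
      have := mul_le_mul_of_nonneg_left (log_le_log h hle) h.le
      linarith
  calc (p.bind k).entropy
      = ∑ b, ∑ a, ((p a).toReal * (k a b).toReal) * -log (p.bind k b).toReal := by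
        refine Finset.sum_congr rfl fun b _ => ?_
        rw [← Finset.sum_mul, ← toReal_bind, negMulLog]
        ring
    _ ≤ ∑ b, ∑ a, ((k a b).toReal * negMulLog (p a).toReal +
          (p a).toReal * negMulLog (k a b).toReal) :=
        Finset.sum_le_sum fun b _ => Finset.sum_le_sum fun a _ => key a b
    _ = _ := by
        rw [Finset.sum_comm]
        simp_rw [Finset.sum_add_distrib, ← Finset.sum_mul, sum_toReal, one_mul, ← Finset.mul_sum]
        rfl

lemma entropy_uniformOfFintype [Fintype α] [Nonempty α] :
    (uniformOfFintype α).entropy = log (Fintype.card α) := by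
  simp [entropy, negMulLog, uniformOfFintype_apply]

/-- A homomorphism maps the uniform distribution to the uniform distribution on its range. -/
lemma entropy_map_uniformOfFintype_addMonoidHom {A B : Type*} [AddCommGroup A] [AddCommGroup B]
    [Fintype A] [Fintype B] (f : A →+ B) :
    ((uniformOfFintype A).map f).entropy = log (Nat.card f.range) := by
  classical
  have hker : ∀ b ∈ f.range, ((uniformOfFintype A).map f b).toReal = (Nat.card f.range : ℝ)⁻¹ := by
    rintro _ ⟨a, rfl⟩
    have hfib : (Finset.univ.filter fun x => f x = f a).card = Nat.card f.ker := by
      rw [← Fintype.card_subtype, ← Nat.card_eq_fintype_card]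
      refine Nat.card_congr ⟨fun x => ⟨x.1 - a, by simp [AddMonoidHom.mem_ker, x.2]⟩,
        fun y => ⟨y.1 + a, by simp [(AddMonoidHom.mem_ker).1 y.2]⟩, fun x => by simp, fun y => by simp⟩
    have hcard : Nat.card A = Nat.card f.range * Nat.card f.ker := by
      rw [AddSubgroup.card_eq_card_quotient_mul_card_addSubgroup f.ker,
        Nat.card_congr (QuotientAddGroup.quotientKerEquivRange f).toEquiv]
    rw [toReal_map]
    simp only [uniformOfFintype_apply, ENNReal.toReal_inv, ENNReal.toReal_natCast,
      Finset.sum_const, nsmul_eq_mul, hfib]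
    rw [← Nat.card_eq_fintype_card, hcard]
    have : (Nat.card f.ker : ℝ) ≠ 0 := by exact_mod_cast Nat.card_pos.ne'
    push_cast
    rw [mul_inv, mul_comm, mul_assoc, inv_mul_cancel₀ this, mul_one]
  have hout : ∀ b ∉ f.range, ((uniformOfFintype A).map f b).toReal = 0 := by
    intro b hb
    rw [toReal_map, Finset.filter_false_of_mem, Finset.sum_empty]
    exact fun a _ h => hb ⟨a, h⟩
  have hR : (Nat.card f.range : ℝ) ≠ 0 := by exact_mod_cast Nat.card_pos.ne'
  rw [entropy, ← Finset.sum_subset (Finset.subset_univ (Finset.univ.filter (· ∈ f.range)))]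
  · rw [Finset.sum_congr rfl fun b hb => by rw [hker b (Finset.mem_filter.1 hb).2],
      Finset.sum_const, ← Fintype.card_subtype, ← Nat.card_eq_fintype_card, nsmul_eq_mul,
      negMulLog, log_inv]
    change (Nat.card f.range : ℝ) * _ = _
    field_simp
  · intro b _ hb
    rw [hout b (by simpa using hb), negMulLog_zero]

lemma entropy_map_uniformOfFintype_linearMap {F A B : Type*} [Field F] [Fintype F]
    [AddCommGroup A] [AddCommGroup B] [Module F A] [Module F B] [Fintype A] [Fintype B]
    (f : A →ₗ[F] B) :
    ((uniformOfFintype A).map f).entropy =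
      Module.finrank F (LinearMap.range f) * log (Fintype.card F) := by
  have h := entropy_map_uniformOfFintype_addMonoidHom f.toAddMonoidHom
  have hc : Nat.card f.toAddMonoidHom.range = Nat.card (LinearMap.range f) := rfl
  rw [hc, Module.natCard_eq_pow_finrank (K := F), Nat.card_eq_fintype_card, Nat.cast_pow,
    log_pow] at h
  exact h

end PMF

/-- A bound on the sum over every `K`-subset bounds the total sum, and if the latter bound is sharp
then all terms are equal. -/
lemma sum_le_of_forall_injective_sum_le {K N : ℕ} (hK : 0 < K) (hKN : K < N) (r : Fin N → ℕ) (d : ℕ)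
    (h : ∀ e : Fin K → Fin N, Function.Injective e → ∑ k, r (e k) ≤ d) :
    K * ∑ i, r i ≤ N * d ∧ (K * ∑ i, r i = N * d → ∀ i i', r i = r i') := by
  have : NeZero N := ⟨by omega⟩
  -- Cyclic windows of length `K`, relabelled by `τ`. For fixed `τ` the `N` windows cover every
  -- index exactly `K` times, which replaces the average over all `K`-subsets.
  let e : Equiv.Perm (Fin N) → Fin N → Fin K → Fin N :=
    fun τ c k => τ (c + Fin.castLE hKN.le k)
  have he : ∀ τ c, Function.Injective (e τ c) := fun τ c k k' hk => by
    simpa [e] using hk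
  have hsum : ∀ τ : Equiv.Perm (Fin N), ∑ c, ∑ k, r (e τ c k) = K * ∑ i, r i := by
    intro τ
    rw [Finset.sum_comm]
    have : ∀ k : Fin K, ∑ c, r (e τ c k) = ∑ i, r i := fun k =>
      Equiv.sum_comp ((Equiv.addRight (Fin.castLE hKN.le k)).trans τ) r
    simp [this]
  have hle : ∀ τ c, ∑ k, r (e τ c k) ≤ d := fun τ c => h _ (he τ c)
  have hd : ∑ _c : Fin N, d = N * d := by simp
  refine ⟨?_, fun heq i i' => ?_⟩
  · rw [← hsum 1, ← hd]
    exact Finset.sum_le_sum fun c _ => hle 1 c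
  · have hall : ∀ τ c, ∑ k, r (e τ c k) = d := fun τ c =>
      (Finset.sum_eq_sum_iff_of_le fun c _ => hle τ c).1 (by rw [hsum, heq, hd]) c
        (Finset.mem_univ c)
    rcases eq_or_ne i i' with rfl | hne
    · rfl
    obtain ⟨K, rfl⟩ : ∃ k, K = k + 1 := ⟨K - 1, by omega⟩
    -- The window length is now `K + 1`, so the windows starting at `0` and at `1` differ only in
    -- the positions `0` and `K + 1`. If `τ` puts `i` and `i'` there, equality of the two window
    -- sums gives `r i = r i'`.
    let z : Fin N := ⟨K + 1, hKN⟩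
    have hz : (0 : Fin N) ≠ z := by
      intro hz
      simpa [z] using congrArg Fin.val hz
    obtain ⟨τ, h0, h1⟩ : ∃ τ : Equiv.Perm (Fin N), τ 0 = i ∧ τ z = i' := by
      refine ⟨(Equiv.swap 0 i).trans (Equiv.swap (Equiv.swap 0 i z) i'), ?_, ?_⟩
      · simp only [Equiv.trans_apply, Equiv.swap_apply_left]
        refine Equiv.swap_apply_of_ne_of_ne ?_ hne
        intro hh
        have := congrArg (Equiv.swap 0 i) hh
        simp at this
        exact hz this
      · simp
    have e0 := hall τ 0
    have e1 := hall τ 1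
    rw [Fin.sum_univ_succ] at e0
    rw [Fin.sum_univ_castSucc] at e1
    have hmid : ∀ k : Fin K, e τ 0 k.succ = e τ 1 k.castSucc := by
      intro k
      simp only [e]
      congr 1
      ext
      have hk : (k : ℕ) + 1 < N := by omega
      simp [Fin.val_add, Nat.mod_eq_of_lt (show 1 < N by omega), add_comm, Nat.mod_eq_of_lt hk]
    have hfirst : e τ 0 0 = i := by
      rw [← h0]
      simp only [e, zero_add]
      rfl
    have hlast : e τ 1 (Fin.last K) = i' := by
      rw [← h1]
      simp only [e, z]
      congr 1
      ext
      simp [Fin.val_add, Nat.mod_eq_of_lt (show 1 < N by omega), add_comm, Nat.mod_eq_of_lt hKN]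
    simp only [hmid, hfirst] at e0
    rw [hlast] at e1
    omega

/-! ### Ranks of queries to an MDS-coded store -/

section LinearAlgebra

variable {F : Type u} [Field F] {K N M c : ℕ}

lemma finrank_submodule_pi {ι : Type*} [Fintype ι] {V : ι → Type*} [∀ i, AddCommGroup (V i)]
    [∀ i, Module F (V i)] [∀ i, FiniteDimensional F (V i)] (p : ∀ i, Submodule F (V i)) :
    Module.finrank F (Submodule.pi Set.univ p) = ∑ i, Module.finrank F (p i) := by
  rw [← Module.finrank_pi_fintype F]
  refine LinearEquiv.finrank_eq
    { toFun := fun x i => ⟨x.1 i, x.2 i (Set.mem_univ i)⟩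
      invFun := fun y => ⟨fun i => y i, fun i _ => (y i).2⟩
      map_add' := fun _ _ => rfl
      map_smul' := fun _ _ => rfl
      left_inv := fun _ => rfl
      right_inv := fun _ => rfl }

/-- The linear map computing an answer, with all records outside `T` replaced by zero. -/
def answerMap {γ : ℕ} (T : Finset (Fin M)) (Q : Fin M → Matrix (Fin c) (Fin γ) F) :
    (Fin M → Fin c → F) →ₗ[F] (Fin γ → F) :=
  ∑ j ∈ T, (Q j).vecMulLinear ∘ₗ LinearMap.proj j

lemma answerMap_apply {γ : ℕ} (T : Finset (Fin M)) (Q : Fin M → Matrix (Fin c) (Fin γ) F)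
    (x : Fin M → Fin c → F) : answerMap T Q x = ∑ j ∈ T, Matrix.vecMul (x j) (Q j) := by
  simp [answerMap, LinearMap.sum_apply]

/-- The rank of a query restricted to the records in `T`. -/
def queryRank {γ : ℕ} (T : Finset (Fin M)) (Q : Fin M → Matrix (Fin c) (Fin γ) F) : ℕ :=
  Module.finrank F (LinearMap.range (answerMap T Q))

lemma queryRank_empty {γ : ℕ} (Q : Fin M → Matrix (Fin c) (Fin γ) F) : queryRank ∅ Q = 0 := by
  rw [queryRank, answerMap, Finset.sum_empty, LinearMap.range_zero, finrank_bot]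

/-- The map from the records to the content of server `i`. -/
def storedMap (G : Matrix (Fin K) (Fin N) F) (M c : ℕ) (i : Fin N) :
    (Fin M → Matrix (Fin K) (Fin c) F) →ₗ[F] (Fin M → Fin c → F) where
  toFun W j := Matrix.vecMul (G.col i) (W j)
  map_add' _ _ := funext fun _ => Matrix.vecMul_add _ _ _
  map_smul' _ _ := funext fun _ => by simp [Matrix.vecMul_smul]

/-- The map from the records to all the answers, with the records outside `T` replaced by zero. -/
def jointMap (G : Matrix (Fin K) (Fin N) F) {γ : Fin N → ℕ} (T : Finset (Fin M))
    (Q : ∀ i, Fin M → Matrix (Fin c) (Fin (γ i)) F) :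
    (Fin M → Matrix (Fin K) (Fin c) F) →ₗ[F] (∀ i, Fin (γ i) → F) :=
  LinearMap.pi fun i => answerMap T (Q i) ∘ₗ storedMap G M c i

variable (G : Matrix (Fin K) (Fin N) F) {γ : Fin N → ℕ}

lemma jointMap_apply (T : Finset (Fin M)) (Q : ∀ i, Fin M → Matrix (Fin c) (Fin (γ i)) F)
    (W : Fin M → Matrix (Fin K) (Fin c) F) (i : Fin N) :
    jointMap G T Q W i = ∑ j ∈ T, Matrix.vecMul (Matrix.vecMul (G.col i) (W j)) (Q i j) := by
  simp only [jointMap, LinearMap.pi_apply, LinearMap.comp_apply, answerMap_apply]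
  rfl

lemma finrank_range_jointMap_le (T : Finset (Fin M))
    (Q : ∀ i, Fin M → Matrix (Fin c) (Fin (γ i)) F) :
    Module.finrank F (LinearMap.range (jointMap G T Q)) ≤ ∑ i, queryRank T (Q i) := by
  simp_rw [queryRank]
  rw [← finrank_submodule_pi]
  refine Submodule.finrank_mono ?_
  rintro _ ⟨W, rfl⟩ i _
  exact ⟨storedMap G M c i W, rfl⟩

variable {G}

/-- A codeword vanishing at `K` places has weight at most `N - K`, below the minimum distance. -/
lemma IsMDSGenerator.eq_zero [DecidableEq F] (hG : IsMDSGenerator G) {u : Fin K → F}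
    {s : Finset (Fin N)} (hs : K ≤ s.card) (h : ∀ i ∈ s, Matrix.vecMul u G i = 0) : u = 0 := by
  by_contra hu
  have h1 := hG.2 u hu
  have h2 : hammingNorm (Matrix.vecMul u G) ≤ sᶜ.card := by
    refine Finset.card_le_card fun i hi => ?_
    simp only [Finset.mem_filter, Finset.mem_univ, true_and] at hi
    exact Finset.mem_compl.2 fun hi' => hi (h i hi')
  have h3 := Finset.card_compl_add_card s
  rw [Fintype.card_fin] at h3
  omega

/-- Any contents of `K` servers of an MDS-coded system arise from some records. -/
lemma IsMDSGenerator.exists_storedMap_eq [DecidableEq F] (hG : IsMDSGenerator G)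
    {e : Fin K → Fin N} (he : Function.Injective e) (x : Fin K → Fin M → Fin c → F) :
    ∃ W, ∀ k, storedMap G M c (e k) W = x k := by
  have hA : IsUnit (G.submatrix id e) := by
    rw [← Matrix.vecMul_injective_iff_isUnit,
      ← Matrix.coe_vecMulLinear, ← LinearMap.ker_eq_bot, LinearMap.ker_eq_bot']
    intro u hu
    refine hG.eq_zero (s := Finset.univ.map ⟨e, he⟩) (by simp) fun i hi => ?_
    obtain ⟨k, -, rfl⟩ := Finset.mem_map.1 hi
    exact congrFun hu k
  have hdet : IsUnit (G.submatrix id e).transpose.det := by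
    rw [Matrix.det_transpose]
    exact (Matrix.isUnit_iff_isUnit_det _).1 hA
  refine ⟨fun j => (G.submatrix id e).transpose⁻¹ * Matrix.of fun k => x k j, fun k => funext fun j =>
    funext fun l => ?_⟩
  have := congrFun (congrFun (Matrix.mul_nonsing_inv_cancel_left (A := (G.submatrix id e).transpose)
    (Matrix.of fun k => x k j) hdet) k) l
  exact this

/-- The contents of `K` servers can be prescribed freely, so projecting the joint answers to these
servers hits the whole product of the individual ranges. -/
lemma sum_queryRank_le_finrank_range_jointMap [DecidableEq F] (hG : IsMDSGenerator G)
    (T : Finset (Fin M)) (Q : ∀ i, Fin M → Matrix (Fin c) (Fin (γ i)) F)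
    {e : Fin K → Fin N} (he : Function.Injective e) :
    ∑ k, queryRank T (Q (e k)) ≤ Module.finrank F (LinearMap.range (jointMap G T Q)) := by
  let proj : (∀ i, Fin (γ i) → F) →ₗ[F] (∀ k, Fin (γ (e k)) → F) :=
    LinearMap.pi fun k => LinearMap.proj (e k)
  simp_rw [queryRank]
  rw [← finrank_submodule_pi]
  refine (Submodule.finrank_mono ?_).trans (Submodule.finrank_map_le proj _)
  intro y hy
  choose x hx using fun k => hy k (Set.mem_univ k)
  obtain ⟨W, hW⟩ := hG.exists_storedMap_eq he x
  refine ⟨_, ⟨W, rfl⟩, funext fun k => ?_⟩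
  rw [← hx k, ← hW k]
  rfl

/-- If a contribution of record `θ` equals some interference, the difference is a choice of records
with all answers zero, so decodability forces record `θ` to vanish. Hence the contribution of `θ` is
injective, of dimension `K * c`, and meets the interference space trivially. -/
lemma add_finrank_range_jointMap_erase_le {θ : Fin M} {T : Finset (Fin M)} (hθ : θ ∈ T)
    {Q : ∀ i, Fin M → Matrix (Fin c) (Fin (γ i)) F}
    (hQ : ∀ W, jointMap G Finset.univ Q W = 0 → W θ = 0) :
    K * c + Module.finrank F (LinearMap.range (jointMap G (T.erase θ) Q)) ≤
      Module.finrank F (LinearMap.range (jointMap G T Q)) := by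
  let B : Matrix (Fin K) (Fin c) F →ₗ[F] (∀ i, Fin (γ i) → F) :=
    jointMap G T Q ∘ₗ LinearMap.single F (fun _ => Matrix (Fin K) (Fin c) F) θ
  have hrestrict : ∀ (S : Finset (Fin M)) (W : Fin M → Matrix (Fin K) (Fin c) F),
      jointMap G S Q W = jointMap G Finset.univ Q (fun j => if j ∈ S then W j else 0) := by
    intro S W
    funext i
    rw [jointMap_apply, jointMap_apply, ← Finset.sum_subset (Finset.subset_univ S)]
    · exact Finset.sum_congr rfl fun j hj => by rw [if_pos hj]
    · intro j _ hj
      simp [if_neg hj]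
  have hzero : ∀ (W : Fin M → Matrix (Fin K) (Fin c) F) X,
      jointMap G (T.erase θ) Q W = B X → X = 0 := by
    intro W X h
    have h' : jointMap G T Q (Pi.single θ X) - jointMap G (T.erase θ) Q W = 0 := by
      rw [h]
      exact sub_self _
    rw [hrestrict, hrestrict (T.erase θ), ← map_sub] at h'
    simpa [hθ] using hQ _ h'
  have hB : Module.finrank F (LinearMap.range B) = K * c := by
    rw [LinearMap.finrank_range_of_inj, Module.finrank_matrix]
    · simp
    · rw [← LinearMap.ker_eq_bot, LinearMap.ker_eq_bot']
      exact fun X hX => hzero 0 X (by rw [map_zero, hX])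
  have hdisj : LinearMap.range B ⊓ LinearMap.range (jointMap G (T.erase θ) Q) = ⊥ := by
    rw [eq_bot_iff]
    rintro _ ⟨⟨X, rfl⟩, ⟨W, hW⟩⟩
    rw [hzero W X hW, map_zero]
    exact Submodule.zero_mem _
  have hsum := Submodule.finrank_sup_add_finrank_inf_eq (LinearMap.range B)
    (LinearMap.range (jointMap G (T.erase θ) Q))
  rw [hdisj, finrank_bot, add_zero, hB] at hsum
  rw [← hsum]
  refine Submodule.finrank_mono (sup_le (LinearMap.range_comp_le_range _ _) ?_)
  rintro _ ⟨W, rfl⟩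
  refine ⟨fun j => if j ∈ T.erase θ then W j else 0, ?_⟩
  rw [hrestrict (T.erase θ), hrestrict T]
  congr 1
  funext j
  by_cases hj : j ∈ T.erase θ
  · simp [hj, Finset.mem_of_mem_erase hj]
  · simp [hj]

/-- The interference inequality for a decodable linear query, with its equality case. -/
lemma queryRank_erase_le [DecidableEq F] (hG : IsMDSGenerator G) (hK : 0 < K) (hKN : K < N)
    {θ : Fin M} {T : Finset (Fin M)} (hθ : θ ∈ T)
    {Q : ∀ i, Fin M → Matrix (Fin c) (Fin (γ i)) F}
    (hQ : ∀ W, jointMap G Finset.univ Q W = 0 → W θ = 0) :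
    N * (K * c) + K * ∑ i, queryRank (T.erase θ) (Q i) ≤ N * ∑ i, queryRank T (Q i) ∧
      (N * (K * c) + K * ∑ i, queryRank (T.erase θ) (Q i) = N * ∑ i, queryRank T (Q i) →
        ∀ i i', queryRank (T.erase θ) (Q i) = queryRank (T.erase θ) (Q i')) := by
  have h1 := sum_le_of_forall_injective_sum_le hK hKN (fun i => queryRank (T.erase θ) (Q i)) _
    fun e he => sum_queryRank_le_finrank_range_jointMap hG (T.erase θ) Q he
  have h2 := Nat.mul_le_mul_left N ((add_finrank_range_jointMap_erase_le hθ hQ).trans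
    (finrank_range_jointMap_le G T Q))
  rw [mul_add] at h2
  exact ⟨by linarith [h1.1], fun h => h1.2 (by linarith [h1.1])⟩

lemma queryRank_singleton_le_nonzeroRows [Fintype F] [DecidableEq F] {γ : ℕ}
    (Q : Fin M → Matrix (Fin c) (Fin γ) F) (j : Fin M) :
    queryRank {j} Q ≤ CodedPIRProtocol.nonzeroRows (Q j) := by
  rw [queryRank, CodedPIRProtocol.nonzeroRows]
  classical
  refine le_trans (Submodule.finrank_mono ?_) ((finrank_span_finset_le_card
    ((Finset.univ.filter fun r => (Q j).row r ≠ 0).image (Q j).row)).trans Finset.card_image_le)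
  rintro _ ⟨x, rfl⟩
  rw [answerMap_apply, Finset.sum_singleton, Matrix.vecMul_eq_sum]
  refine Submodule.sum_mem _ fun r _ => Submodule.smul_mem _ _ ?_
  by_cases hr : (Q j).row r = 0
  · change (Q j).row r ∈ _
    rw [hr]
    exact Submodule.zero_mem _
  · exact Submodule.subset_span (by simpa using ⟨r, hr, rfl⟩)

end LinearAlgebra

/-! ### Laws of answers and queries for general schemes -/

namespace CodedPIRProtocol

variable {F : Type u} [Field F] [Fintype F] [DecidableEq F] {K N M : ℕ}
  {G : Matrix (Fin K) (Fin N) F}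

omit [DecidableEq F] in
lemma map_jointLaw (P : CodedPIRProtocol F M G) {α : Type*} (f : P.Records × P.Seed → α) :
    P.jointLaw.map f =
      P.seedLaw.bind fun s => (PMF.uniformOfFintype P.Records).map fun W => f (W, s) := by
  rw [jointLaw, PMF.map_bind]
  simp_rw [PMF.map_comp, ← PMF.bind_pure_comp]
  rw [PMF.bind_comm]
  rfl

omit [DecidableEq F] in
lemma map_jointLaw_seed (P : CodedPIRProtocol F M G) {α : Type*} (f : P.Seed → α) :
    P.jointLaw.map (fun x => f x.2) = P.seedLaw.map f := by
  rw [map_jointLaw, ← PMF.bind_pure_comp]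
  exact congrArg P.seedLaw.bind (funext fun s => PMF.map_const _ (f s))

lemma entropyBase_eq (b : ℝ) {α : Type*} [Fintype α] (p : PMF α) :
    entropyBase b p = p.entropy / log b := rfl

omit [DecidableEq F] in
variable (F) in
lemma log_card_pos : 0 < log (Fintype.card F : ℝ) :=
  log_pos (by exact_mod_cast Fintype.one_lt_card)

/-- A scheme downloads at least as many symbols as a record has. -/
lemma IsCorrect.le_downloadSize {P : CodedPIRProtocol F M G} (hP : P.IsCorrect) (θ : Fin M) :
    ((K * P.cols : ℕ) : ℝ) ≤ P.downloadSize θ := by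
  classical
  have hq := log_card_pos F
  let U := PMF.uniformOfFintype P.Records
  -- The seed may range over an infinite set. Only the function from records to answers that it
  -- induces matters, and there are finitely many such functions.
  let h : P.Seed → P.Records → ∀ i, P.Answer i := fun s W i => P.answer θ i W s
  let ν := P.seedLaw.map h
  have hlaw : ∀ i, P.jointLaw.map (fun x => P.answer θ i x.1 x.2) =
      ν.bind fun φ => (U.map φ).map fun a => a i := by
    intro i
    rw [map_jointLaw, PMF.bind_map]
    simp_rw [PMF.map_comp]
    rfl
  have hφ : ∀ φ ∈ ν.support, (K * P.cols : ℕ) * log (Fintype.card F) ≤ (U.map φ).entropy := by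
    intro φ hφ
    obtain ⟨s, hs, rfl⟩ := (PMF.mem_support_map_iff _ _ _).1 hφ
    obtain ⟨dec, hdec⟩ := hP θ
    have h1 := PMF.entropy_map_uniformOfFintype_linearMap
      (LinearMap.proj (R := F) (φ := fun _ : Fin M => Matrix (Fin K) (Fin P.cols) F) θ)
    rw [LinearMap.range_eq_top.2 (LinearMap.proj_surjective θ), finrank_top,
      Module.finrank_matrix] at h1
    have h2 : U.map (LinearMap.proj (R := F)
        (φ := fun _ : Fin M => Matrix (Fin K) (Fin P.cols) F) θ) =
        (U.map (h s)).map fun a => dec a (P.query θ s) s := by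
      rw [PMF.map_comp]
      exact congrArg U.map (funext fun W => (hdec W s hs).symm)
    calc _ = (U.map (LinearMap.proj (R := F)
        (φ := fun _ : Fin M => Matrix (Fin K) (Fin P.cols) F) θ)).entropy := by
          rw [h1]
          simp
      _ ≤ _ := by
          rw [h2]
          exact PMF.entropy_map_le _ _
  have hmain : (K * P.cols : ℕ) * log (Fintype.card F) ≤
      ∑ i, (P.jointLaw.map fun x => P.answer θ i x.1 x.2).entropy := by
    calc _ = ∑ φ, (ν φ).toReal * ((K * P.cols : ℕ) * log (Fintype.card F)) := by
          rw [← Finset.sum_mul, PMF.sum_toReal, one_mul]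
      _ ≤ ∑ φ, (ν φ).toReal * ∑ i, ((U.map φ).map fun a => a i).entropy := by
          refine Finset.sum_le_sum fun φ _ => ?_
          by_cases h : φ ∈ ν.support
          · exact mul_le_mul_of_nonneg_left ((hφ φ h).trans (PMF.entropy_le_sum_entropy_map _))
              (ν.toReal_nonneg φ)
          · simp [(ν.apply_eq_zero_iff φ).2 h]
      _ = ∑ i, ∑ φ, (ν φ).toReal * ((U.map φ).map fun a => a i).entropy := by
          simp_rw [Finset.mul_sum]
          rw [Finset.sum_comm]
      _ ≤ _ := by
          refine Finset.sum_le_sum fun i _ => ?_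
          rw [hlaw i]
          exact PMF.sum_mul_entropy_le_entropy_bind _ _
  simp_rw [downloadSize, entropyBase_eq]
  rw [← Finset.sum_div, le_div_iff₀ hq]
  exact hmain

omit [DecidableEq F] in
/-- The law of the query of a private scheme does not depend on the wanted record. -/
lemma IsPrivate.map_query {P : CodedPIRProtocol F M G} (hP : P.IsPrivate) (i : Fin N)
    (θ θ' : Fin M) : P.seedLaw.map (fun s => P.query θ s i) =
      P.seedLaw.map (fun s => P.query θ' s i) := by
  have h := congrArg (PMF.map Prod.fst) (hP i θ θ')
  rw [PMF.map_comp, PMF.map_comp] at h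
  rw [← map_jointLaw_seed, ← map_jointLaw_seed]
  exact h

end CodedPIRProtocol

lemma IsMDSGenerator.storedMap_surjective {F : Type u} [Field F] [DecidableEq F] {K N : ℕ}
    {G : Matrix (Fin K) (Fin N) F} (hG : IsMDSGenerator G) (hK : 0 < K) (hKN : K ≤ N)
    (M c : ℕ) (i : Fin N) : Function.Surjective (storedMap G M c i) := by
  intro x
  obtain ⟨W, hW⟩ := hG.exists_storedMap_eq
    (e := fun k => Equiv.swap (Fin.castLE hKN ⟨0, hK⟩) i (Fin.castLE hKN k))
    (fun k k' h => by simpa using h) (fun _ => x)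
  exact ⟨W, by simpa using hW ⟨0, hK⟩⟩

/-! ### Linear schemes: decodability, privacy and answer entropy -/

namespace CodedPIRProtocol.Linear

variable {F : Type u} [Field F] [Fintype F] [DecidableEq F] {K N M : ℕ}
  {G : Matrix (Fin K) (Fin N) F} {P : CodedPIRProtocol F M G} (lin : P.Linear)

omit [Fintype F] [DecidableEq F] in
lemma jointMap_eq {θ : Fin M} {s : P.Seed} (hs : s ∈ P.seedLaw.support) (W : P.Records)
    (i : Fin N) : jointMap G Finset.univ (lin.Q θ s) W i = lin.toVec i (P.answer θ i W s) := by
  rw [lin.answer_eq θ s hs, jointMap_apply]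
  rfl

omit [Fintype F] [DecidableEq F] in
lemma decodable (hP : P.IsCorrect) {θ : Fin M} {s : P.Seed} (hs : s ∈ P.seedLaw.support)
    (W : P.Records) (hW : jointMap G Finset.univ (lin.Q θ s) W = 0) : W θ = 0 := by
  obtain ⟨dec, hdec⟩ := hP θ
  refine (hdec W s hs).symm.trans (Eq.trans ?_ (hdec 0 s hs))
  congr 1
  funext i
  apply (lin.toVec i).injective
  rw [← lin.jointMap_eq hs, ← lin.jointMap_eq hs, hW, map_zero]

/-- The law of the query matrices sent to server `i`. -/
def queryLaw (θ : Fin M) (i : Fin N) :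
    PMF (Fin M → Matrix (Fin P.cols) (Fin (lin.γ i)) F) :=
  P.seedLaw.map fun s => lin.Q θ s i

/-- Privacy concerns the abstract query, not the matrices `Q`. But the matrices are a function of
the query: their rows are the answers to unit vectors as stored contents, and every content of a
single server occurs. -/
lemma queryLaw_eq (hG : IsMDSGenerator G) (hK : 0 < K) (hKN : K ≤ N) (hP : P.IsPrivate)
    (θ θ' : Fin M) (i : Fin N) : lin.queryLaw θ i = lin.queryLaw θ' i := by
  let ext : P.Query i → Fin M → Matrix (Fin P.cols) (Fin (lin.γ i)) F := fun q j r =>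
    lin.toVec i (P.ans i q (Pi.single j (Pi.single r 1)))
  have hext : ∀ θ, lin.queryLaw θ i = (P.seedLaw.map fun s => P.query θ s i).map ext := by
    intro θ
    rw [queryLaw, PMF.map_comp]
    refine PMF.map_congr_of_support _ fun s hs => funext fun j => funext fun r => ?_
    obtain ⟨W, hW⟩ := hG.storedMap_surjective hK hKN M P.cols i (Pi.single j (Pi.single r 1))
    have hW' : P.stored i W = Pi.single j (Pi.single r 1) := hW
    have h := lin.answer_eq θ s hs i W
    rw [answer, hW', Finset.sum_eq_single j
      (fun j' _ hj => by rw [Pi.single_eq_of_ne hj, Matrix.zero_vecMul])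
      (fun h => absurd (Finset.mem_univ j) h), Pi.single_eq_same,
      Matrix.single_one_vecMul] at h
    exact h.symm
  rw [hext, hext, hP.map_query i θ θ']

/-- The entropy of the answer of server `i` before conditioning on the query. -/
lemma entropy_queryLaw_bind_le (θ : Fin M) (i : Fin N) :
    ((lin.queryLaw θ i).bind fun Q => (PMF.uniformOfFintype P.Records).map
      (answerMap Finset.univ Q ∘ₗ storedMap G M P.cols i)).entropy ≤
      (P.jointLaw.map fun x => P.answer θ i x.1 x.2).entropy := by
  refine le_trans (le_of_eq ?_) (PMF.entropy_map_le _ (lin.toVec i))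
  congr 1
  rw [PMF.map_comp, map_jointLaw, queryLaw, PMF.bind_map]
  ext a
  rw [PMF.bind_apply, PMF.bind_apply]
  refine tsum_congr fun s => ?_
  by_cases hs : s ∈ P.seedLaw.support
  · congr 2
    refine congrArg (fun f => PMF.map f _) (funext fun W => ?_)
    exact lin.jointMap_eq hs W i
  · simp [(P.seedLaw.apply_eq_zero_iff s).2 hs]

lemma entropy_map_answerMap (hG : IsMDSGenerator G) (hK : 0 < K) (hKN : K ≤ N) (i : Fin N)
    (Q : Fin M → Matrix (Fin P.cols) (Fin (lin.γ i)) F) :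
    ((PMF.uniformOfFintype P.Records).map
      (answerMap Finset.univ Q ∘ₗ storedMap G M P.cols i)).entropy =
      queryRank Finset.univ Q * log (Fintype.card F) := by
  rw [PMF.entropy_map_uniformOfFintype_linearMap, LinearMap.range_comp_of_range_eq_top _
    (LinearMap.range_eq_top.2 (hG.storedMap_surjective hK hKN M P.cols i))]
  rfl

end CodedPIRProtocol.Linear

/-- `1 + ρ + ⋯ + ρ ^ (t - 1)` with `ρ = K / N`. -/
def rateSum (K N t : ℕ) : ℝ := ∑ k ∈ Finset.range t, ((K : ℝ) / N) ^ k

lemma mul_rateSum_succ {K N : ℕ} (hN : 0 < N) (t : ℕ) :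
    N * rateSum K N (t + 1) = N + K * rateSum K N t := by
  have : (N : ℝ) ≠ 0 := by positivity
  rw [rateSum, Finset.sum_range_succ', rateSum, pow_zero, mul_add, mul_one, add_comm]
  simp_rw [pow_succ, ← Finset.sum_mul]
  field_simp

/-! ### Converse bound for mean ranks -/

namespace CodedPIRProtocol.Linear

variable {F : Type u} [Field F] [Fintype F] [DecidableEq F] {K N M : ℕ}
  {G : Matrix (Fin K) (Fin N) F} {P : CodedPIRProtocol F M G} (lin : P.Linear)

/-- The mean over the seed of the total rank of the queries restricted to the records in `T`. -/
def meanRank (θ : Fin M) (T : Finset (Fin M)) : ℝ :=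
  ∑ i, ∑ Q, (lin.queryLaw θ i Q).toReal * queryRank T Q

omit [DecidableEq F] in
lemma meanRank_eq (θ : Fin M) (T : Finset (Fin M)) : lin.meanRank θ T =
    ∑ Q, (P.seedLaw.map (lin.Q θ) Q).toReal * ((∑ i, queryRank T (Q i) : ℕ) : ℝ) := by
  classical
  have h : ∀ i, lin.queryLaw θ i = (P.seedLaw.map (lin.Q θ)).map fun Q => Q i := by
    intro i
    rw [PMF.map_comp]
    rfl
  simp_rw [meanRank, h]
  rw [Finset.sum_congr rfl fun i _ => PMF.sum_map_mul (P.seedLaw.map (lin.Q θ)) (fun Q => Q i)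
    fun Q => (queryRank T Q : ℝ), Finset.sum_comm]
  push_cast
  simp_rw [Finset.mul_sum]

lemma meanRank_erase_le (hG : IsMDSGenerator G) (hK : 0 < K) (hKN : K < N) (hP : P.IsCorrect)
    {θ : Fin M} {T : Finset (Fin M)} (hθ : θ ∈ T) :
    N * (K * P.cols : ℕ) + K * lin.meanRank θ (T.erase θ) ≤ N * lin.meanRank θ T ∧
      (N * (K * P.cols : ℕ) + K * lin.meanRank θ (T.erase θ) = N * lin.meanRank θ T →
        ∀ s ∈ P.seedLaw.support,
          N * (K * P.cols) + K * ∑ i, queryRank (T.erase θ) (lin.Q θ s i) =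
            N * ∑ i, queryRank T (lin.Q θ s i)) := by
  classical
  let ν := P.seedLaw.map (lin.Q θ)
  have hle : ∀ Q ∈ Finset.univ, (ν Q).toReal *
      ((N * (K * P.cols) + K * ∑ i, queryRank (T.erase θ) (Q i) : ℕ) : ℝ) ≤
      (ν Q).toReal * ((N * ∑ i, queryRank T (Q i) : ℕ) : ℝ) := by
    intro Q _
    by_cases hQ : Q ∈ ν.support
    · obtain ⟨s, hs, rfl⟩ := (PMF.mem_support_map_iff _ _ _).1 hQ
      refine mul_le_mul_of_nonneg_left ?_ (ν.toReal_nonneg _)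
      exact_mod_cast (queryRank_erase_le hG hK hKN hθ (lin.decodable hP hs)).1
    · simp [(ν.apply_eq_zero_iff Q).2 hQ]
  have hL : N * (K * P.cols : ℕ) + K * lin.meanRank θ (T.erase θ) = ∑ Q, (ν Q).toReal *
      ((N * (K * P.cols) + K * ∑ i, queryRank (T.erase θ) (Q i) : ℕ) : ℝ) := by
    rw [meanRank_eq, Finset.mul_sum, ← one_mul ((N : ℝ) * _), ← ν.sum_toReal, Finset.sum_mul,
      ← Finset.sum_add_distrib]
    refine Finset.sum_congr rfl fun Q _ => ?_
    push_cast
    ring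
  have hR : N * lin.meanRank θ T = ∑ Q, (ν Q).toReal * ((N * ∑ i, queryRank T (Q i) : ℕ) : ℝ) := by
    rw [meanRank_eq, Finset.mul_sum]
    refine Finset.sum_congr rfl fun Q _ => ?_
    push_cast
    ring
  rw [hL, hR]
  refine ⟨Finset.sum_le_sum hle, fun h s hs => ?_⟩
  have h1 := (Finset.sum_eq_sum_iff_of_le hle).1 h (lin.Q θ s) (Finset.mem_univ _)
  have hpos : (ν (lin.Q θ s)).toReal ≠ 0 :=
    (PMF.toReal_pos ((PMF.mem_support_map_iff _ _ _).2 ⟨s, hs, rfl⟩)).ne'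
  exact_mod_cast mul_left_cancel₀ hpos h1

/-- Privacy controls each server separately; this suffices because the mean rank is a sum of terms
that each depend on one server's query law. -/
lemma meanRank_eq_of (hG : IsMDSGenerator G) (hK : 0 < K) (hKN : K ≤ N) (hP : P.IsPrivate)
    (θ θ' : Fin M) (T : Finset (Fin M)) : lin.meanRank θ T = lin.meanRank θ' T := by
  simp_rw [meanRank, lin.queryLaw_eq hG hK hKN hP θ θ']

/-- Induction on `T`: an element `θ'` of `T` is declared wanted, the interference inequality is
applied to it, and privacy moves both mean ranks back to `θ`. -/
lemma mul_rateSum_le_meanRank (hG : IsMDSGenerator G) (hK : 0 < K) (hKN : K < N)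
    (hP : P.IsCorrect) (hP' : P.IsPrivate) (θ : Fin M) (T : Finset (Fin M)) :
    (K * P.cols : ℕ) * rateSum K N T.card ≤ lin.meanRank θ T := by
  have hN : (0 : ℝ) < N := by exact_mod_cast hK.trans hKN
  induction hn : T.card generalizing T with
  | zero =>
    simp [Finset.card_eq_zero.1 hn, meanRank, queryRank_empty, rateSum]
  | succ n ih =>
    obtain ⟨θ', hθ'⟩ := Finset.card_pos.1 (by omega : 0 < T.card)
    have h1 := ih (T.erase θ') (by rw [Finset.card_erase_of_mem hθ', hn]; rfl)
    have h2 := (lin.meanRank_erase_le hG hK hKN hP hθ').1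
    rw [lin.meanRank_eq_of hG hK hKN.le hP' θ' θ, lin.meanRank_eq_of hG hK hKN.le hP' θ' θ] at h2
    have h3 := mul_rateSum_succ (K := K) (hK.trans hKN) n
    have h4 := mul_le_mul_of_nonneg_left h1 (Nat.cast_nonneg (α := ℝ) K)
    refine le_of_mul_le_mul_left ?_ hN
    calc (N : ℝ) * ((K * P.cols : ℕ) * rateSum K N (n + 1))
        = (K * P.cols : ℕ) * (N * rateSum K N (n + 1)) := by ring
      _ ≤ _ := by
        rw [h3]
        linarith

/-! ### Rigidity of schemes with minimal download -/

section Optimal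

variable (hG : IsMDSGenerator G) (hK : 0 < K) (hKN : K < N) (hP : P.IsCorrect) (hP' : P.IsPrivate)
  (hD : ∀ θ, P.downloadSize θ ≤ (K * P.cols : ℕ) * rateSum K N M)

lemma queryRank_mul_log_le_entropy (hG : IsMDSGenerator G) (hK : 0 < K) (hKN : K < N)
    (θ : Fin M) (i : Fin N) :
    (∑ Q, (lin.queryLaw θ i Q).toReal * queryRank Finset.univ Q) * log (Fintype.card F) ≤
      (P.jointLaw.map fun x => P.answer θ i x.1 x.2).entropy := by
  refine le_trans (le_of_eq ?_) ((PMF.sum_mul_entropy_le_entropy_bind _ _).trans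
    (lin.entropy_queryLaw_bind_le θ i))
  rw [Finset.sum_mul]
  simp_rw [lin.entropy_map_answerMap hG hK hKN.le, mul_assoc]

lemma meanRank_univ_le_downloadSize (hG : IsMDSGenerator G) (hK : 0 < K) (hKN : K < N)
    (θ : Fin M) : lin.meanRank θ Finset.univ ≤ P.downloadSize θ := by
  simp_rw [downloadSize, entropyBase_eq]
  rw [← Finset.sum_div, le_div_iff₀ (log_card_pos F), meanRank, Finset.sum_mul]
  exact Finset.sum_le_sum fun i _ => lin.queryRank_mul_log_le_entropy hG hK hKN θ i

include hG hK hKN hP hP' hD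

/-- Downward induction from the set of all records, where the download bounds the mean rank from
above. If the value for `insert θ' T` is minimal, the interference inequality leaves no slack for
`T`. -/
lemma meanRank_eq_mul_rateSum (θ : Fin M) (T : Finset (Fin M)) :
    lin.meanRank θ T = (K * P.cols : ℕ) * rateSum K N T.card := by
  have hN : (0 : ℝ) < N := by exact_mod_cast hK.trans hKN
  have hKpos : (0 : ℝ) < K := by exact_mod_cast hK
  induction hn : Tᶜ.card generalizing T with
  | zero =>
    obtain rfl : T = Finset.univ := by
      rwa [Finset.card_eq_zero, Finset.compl_eq_empty_iff] at hn
    refine le_antisymm ?_ (lin.mul_rateSum_le_meanRank hG hK hKN hP hP' θ _)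
    rw [Finset.card_univ, Fintype.card_fin]
    exact (lin.meanRank_univ_le_downloadSize hG hK hKN θ).trans (hD θ)
  | succ n ih =>
    obtain ⟨θ', hθ'⟩ := Finset.card_pos.1 (by omega : 0 < Tᶜ.card)
    have hT := Finset.mem_compl.1 hθ'
    refine le_antisymm ?_ (lin.mul_rateSum_le_meanRank hG hK hKN hP hP' θ _)
    have h1 := ih (insert θ' T) (by
      rw [Finset.compl_insert, Finset.card_erase_of_mem hθ', hn]
      rfl)
    have h2 := (lin.meanRank_erase_le hG hK hKN hP (Finset.mem_insert_self θ' T)).1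
    rw [Finset.erase_insert hT, lin.meanRank_eq_of hG hK hKN.le hP' θ' θ,
      lin.meanRank_eq_of hG hK hKN.le hP' θ' θ, h1, Finset.card_insert_of_notMem hT,
      mul_left_comm, mul_rateSum_succ (hK.trans hKN)] at h2
    refine le_of_mul_le_mul_left ?_ hKpos
    linarith

/-- In an optimal scheme all values of the seed meet the interference inequality. -/
lemma queryRank_erase_eq {θ : Fin M} {T : Finset (Fin M)} (hθ : θ ∈ T) {s : P.Seed}
    (hs : s ∈ P.seedLaw.support) :
    N * (K * P.cols) + K * ∑ i, queryRank (T.erase θ) (lin.Q θ s i) =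
      N * ∑ i, queryRank T (lin.Q θ s i) := by
  refine (lin.meanRank_erase_le hG hK hKN hP hθ).2 ?_ s hs
  obtain ⟨n, hn⟩ : ∃ n, T.card = n + 1 := ⟨T.card - 1, by have := Finset.card_pos.2 ⟨θ, hθ⟩; omega⟩
  rw [lin.meanRank_eq_mul_rateSum hG hK hKN hP hP' hD, lin.meanRank_eq_mul_rateSum hG hK hKN hP hP' hD,
    Finset.card_erase_of_mem hθ, hn, Nat.add_sub_cancel, mul_left_comm (N : ℝ),
    mul_rateSum_succ (hK.trans hKN)]
  ring

/-- In an optimal scheme the rank of the query of a server is the same for all values of the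
seed. -/
lemma sum_queryRank_univ {θ : Fin M} {s : P.Seed} (hs : s ∈ P.seedLaw.support) :
    ((∑ i, queryRank Finset.univ (lin.Q θ s i) : ℕ) : ℝ) =
      (K * P.cols : ℕ) * rateSum K N M := by
  have hq := log_card_pos F
  have hm := lin.meanRank_eq_mul_rateSum hG hK hKN hP hP' hD θ Finset.univ
  rw [Finset.card_univ, Fintype.card_fin] at hm
  have hle := fun i (_ : i ∈ Finset.univ) => lin.queryRank_mul_log_le_entropy hG hK hKN θ i
  have hsum : ∑ i, (P.jointLaw.map fun x => P.answer θ i x.1 x.2).entropy ≤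
      lin.meanRank θ Finset.univ * log (Fintype.card F) := by
    have h := hD θ
    simp_rw [downloadSize, entropyBase_eq] at h
    rw [← Finset.sum_div, div_le_iff₀ hq, ← hm] at h
    exact h
  rw [meanRank, Finset.sum_mul] at hsum
  -- For each server the entropy of the answer equals its conditional entropy given the query
  -- matrices.
  have heq := (Finset.sum_eq_sum_iff_of_le hle).1 (le_antisymm (Finset.sum_le_sum hle) hsum)
  rw [← hm, meanRank, Nat.cast_sum]
  refine Finset.sum_congr rfl fun i hi => ?_
  have hb := lin.entropy_queryLaw_bind_le θ i
  have hlow : ∀ Q, ((PMF.uniformOfFintype P.Records).map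
      (answerMap Finset.univ Q ∘ₗ storedMap G M P.cols i)).entropy =
      queryRank Finset.univ Q * log (Fintype.card F) := lin.entropy_map_answerMap hG hK hKN.le i
  have hcond : ∑ Q, (lin.queryLaw θ i Q).toReal * ((PMF.uniformOfFintype P.Records).map
      (answerMap Finset.univ Q ∘ₗ storedMap G M P.cols i)).entropy =
      (∑ Q, (lin.queryLaw θ i Q).toReal * queryRank Finset.univ Q) * log (Fintype.card F) := by
    rw [Finset.sum_mul]
    simp_rw [hlow, mul_assoc]
  -- Answer and query are therefore independent: the law of the answer given `Q` is the same for all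
  -- `Q` in the support. So is its entropy, which is the rank of `Q` times `log |F|`.
  have hk := PMF.eq_bind_of_entropy_bind_le (lin.queryLaw θ i)
    (fun Q => (PMF.uniformOfFintype P.Records).map
      (answerMap Finset.univ Q ∘ₗ storedMap G M P.cols i)) (by rw [hcond, heq i hi]; exact hb)
    (a := lin.Q θ s i) ((PMF.mem_support_map_iff _ _ _).2 ⟨s, hs, rfl⟩)
  have h1 := congrArg PMF.entropy hk
  have h2 := (PMF.sum_mul_entropy_le_entropy_bind (lin.queryLaw θ i) fun Q =>
    (PMF.uniformOfFintype P.Records).map (answerMap Finset.univ Q ∘ₗ storedMap G M P.cols i))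
  rw [hcond] at h2
  rw [hlow] at h1
  refine mul_right_cancel₀ hq.ne' ?_
  rw [h1]
  exact le_antisymm (hb.trans (heq i hi).ge) h2

/-- In an optimal scheme the ranks of all queries restricted to the records in `T` are
determined by the number of these records. -/
lemma sum_queryRank_eq (T : Finset (Fin M)) :
    (∀ θ, ∀ s ∈ P.seedLaw.support, ((∑ i, queryRank T (lin.Q θ s i) : ℕ) : ℝ) =
      (K * P.cols : ℕ) * rateSum K N T.card) ∧
    (T ≠ Finset.univ → ∀ θ, ∀ s ∈ P.seedLaw.support, ∀ i,
      (N : ℝ) * queryRank T (lin.Q θ s i) = (K * P.cols : ℕ) * rateSum K N T.card) := by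
  have hN : (0 : ℝ) < N := by exact_mod_cast hK.trans hKN
  have hKpos : (0 : ℝ) < K := by exact_mod_cast hK
  induction hn : Tᶜ.card generalizing T with
  | zero =>
    obtain rfl : T = Finset.univ := by
      rwa [Finset.card_eq_zero, Finset.compl_eq_empty_iff] at hn
    refine ⟨fun θ s hs => ?_, fun h => absurd rfl h⟩
    rw [Finset.card_univ, Fintype.card_fin]
    exact lin.sum_queryRank_univ hG hK hKN hP hP' hD hs
  | succ n ih =>
    obtain ⟨θ', hθ'⟩ := Finset.card_pos.1 (by omega : 0 < Tᶜ.card)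
    have hT := Finset.mem_compl.1 hθ'
    have h1 := (ih (insert θ' T) (by
      rw [Finset.compl_insert, Finset.card_erase_of_mem hθ', hn]
      rfl)).1 θ'
    have hone : ∀ s ∈ P.seedLaw.support, ∀ i,
        (N : ℝ) * queryRank T (lin.Q θ' s i) = (K * P.cols : ℕ) * rateSum K N T.card := by
      intro s hs i
      have h2 := lin.queryRank_erase_eq hG hK hKN hP hP' hD (Finset.mem_insert_self θ' T) hs
      -- Here `θ' ∉ T` is the wanted record, and equality in the interference inequality makes the
      -- ranks for `T` equal across servers.
      have h3 := (queryRank_erase_le hG hK hKN (Finset.mem_insert_self θ' T)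
        (lin.decodable hP hs)).2 h2
      rw [Finset.erase_insert hT] at h2 h3
      have h4 : ∑ i', queryRank T (lin.Q θ' s i') = N * queryRank T (lin.Q θ' s i) := by
        rw [Finset.sum_congr rfl fun i' _ => h3 i' i]
        simp
      have h5 := congrArg (Nat.cast (R := ℝ)) h2
      rw [h4, Nat.cast_add, Nat.cast_mul N (∑ i, _), h1 s hs, Finset.card_insert_of_notMem hT,
        mul_left_comm (N : ℝ), mul_rateSum_succ (hK.trans hKN)] at h5
      refine mul_left_cancel₀ hKpos.ne' ?_
      push_cast at h5 ⊢
      linarith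
    -- The value just found concerns one server, whose query matrices have the same support
    -- whichever record is wanted; so it passes from `θ'` to every `θ`.
    have hall : ∀ θ, ∀ s ∈ P.seedLaw.support, ∀ i,
        (N : ℝ) * queryRank T (lin.Q θ s i) = (K * P.cols : ℕ) * rateSum K N T.card := by
      intro θ s hs i
      have hmem : lin.Q θ s i ∈ (lin.queryLaw θ' i).support := by
        rw [lin.queryLaw_eq hG hK hKN.le hP' θ' θ]
        exact (PMF.mem_support_map_iff _ _ _).2 ⟨s, hs, rfl⟩
      obtain ⟨s', hs', h⟩ := (PMF.mem_support_map_iff _ _ _).1 hmem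
      rw [← h]
      exact hone s' hs' i
    refine ⟨fun θ s hs => ?_, fun _ => hall⟩
    refine mul_left_cancel₀ hN.ne' ?_
    rw [Nat.cast_sum, Finset.mul_sum, Finset.sum_congr rfl fun i _ => hall θ s hs i]
    simp

/-- The sub-packetization bound. -/
lemma pow_dvd_cols (lin : P.Linear) (hM : 2 ≤ M) : (N / Nat.gcd N K) ^ (M - 1) ∣ P.cols := by
  obtain ⟨m, rfl⟩ : ∃ m, M = m + 2 := ⟨M - 2, by omega⟩
  have hN : (0 : ℝ) < N := by exact_mod_cast hK.trans hKN
  obtain ⟨s, hs⟩ := P.seedLaw.support_nonempty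
  let i : Fin N := ⟨0, hK.trans hKN⟩
  have hrank : ∀ t ≤ m + 1, ∃ h : ℕ, (N : ℝ) * h = (K * P.cols : ℕ) * rateSum K N t := by
    intro t ht
    obtain ⟨T, -, hT⟩ := Finset.exists_subset_card_eq (s := (Finset.univ : Finset (Fin (m + 2))))
      (n := t) (by rw [Finset.card_univ, Fintype.card_fin]; omega)
    refine ⟨_, ((lin.sum_queryRank_eq hG hK hKN hP hP' hD T).2 ?_ 0 s hs i).trans (by rw [hT])⟩
    rintro rfl
    rw [Finset.card_univ, Fintype.card_fin] at hT
    omega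
  obtain ⟨a, ha⟩ := hrank (m + 1) le_rfl
  obtain ⟨b, hb⟩ := hrank m (by omega)
  -- The difference of two consecutive sums isolates the power `ρ ^ m`, with `m = M - 2`; the factor
  -- `K` of `L` and the factor `N` on the left supply one more power.
  have hdiff : (N : ℝ) * ((a : ℝ) - b) = (K * P.cols : ℕ) * ((K : ℝ) / N) ^ m := by
    rw [mul_sub, ha, hb, rateSum, rateSum, Finset.sum_range_succ]
    ring
  have hint : (N : ℤ) ^ (m + 1) * ((a : ℤ) - b) = P.cols * K ^ (m + 1) := by
    have : (N : ℝ) ^ (m + 1) * ((a : ℝ) - b) = P.cols * K ^ (m + 1) := by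
      rw [pow_succ, mul_assoc, hdiff, div_pow]
      push_cast
      field_simp
      ring
    exact_mod_cast this
  have hdvd : N ^ (m + 1) ∣ P.cols * K ^ (m + 1) := by
    have : ((N ^ (m + 1) : ℕ) : ℤ) ∣ ((P.cols * K ^ (m + 1) : ℕ) : ℤ) := by
      push_cast
      exact ⟨_, hint.symm⟩
    exact_mod_cast this
  have hg : 0 < Nat.gcd N K := Nat.gcd_pos_of_pos_right N hK
  have hcop : Nat.Coprime (N / Nat.gcd N K) (K / Nat.gcd N K) := Nat.coprime_div_gcd_div_gcd hg
  have hN' : N = N / Nat.gcd N K * Nat.gcd N K := (Nat.div_mul_cancel (Nat.gcd_dvd_left N K)).symm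
  have hK' : K = K / Nat.gcd N K * Nat.gcd N K := (Nat.div_mul_cancel (Nat.gcd_dvd_right N K)).symm
  have hdvd' : (N / Nat.gcd N K * Nat.gcd N K) ^ (m + 1) ∣
      P.cols * (K / Nat.gcd N K * Nat.gcd N K) ^ (m + 1) := by
    rwa [← hN', ← hK']
  rw [mul_pow, mul_pow, ← mul_assoc] at hdvd'
  exact (hcop.pow _ _).dvd_of_dvd_mul_right (Nat.dvd_of_mul_dvd_mul_right (pow_pos hg _) hdvd')

lemma le_accessNumber (hM : 2 ≤ M) {s : P.Seed} (hs : s ∈ P.seedLaw.support) :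
    M * K * (N / Nat.gcd N K) ^ (M - 1) ≤ lin.accessNumber s := by
  have hc := Nat.le_of_dvd P.cols_pos (lin.pow_dvd_cols hG hK hKN hP hP' hD hM)
  let θ : Fin M := ⟨0, by omega⟩
  have hj : ∀ j, K * P.cols ≤ ∑ i, nonzeroRows (lin.Q θ s i j) := by
    intro j
    have h := (lin.sum_queryRank_eq hG hK hKN hP hP' hD {j}).1 θ s hs
    rw [Finset.card_singleton, rateSum, Finset.sum_range_one, pow_zero, mul_one] at h
    rw [← Nat.cast_injective h]
    exact Finset.sum_le_sum fun i _ => queryRank_singleton_le_nonzeroRows _ j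
  calc M * K * (N / Nat.gcd N K) ^ (M - 1) ≤ M * K * P.cols := Nat.mul_le_mul_left _ hc
    _ = ∑ _j : Fin M, K * P.cols := by simp [mul_assoc]
    _ ≤ ∑ j, ∑ i, nonzeroRows (lin.Q θ s i j) := Finset.sum_le_sum fun j _ => hj j
    _ = ∑ i, ∑ j, nonzeroRows (lin.Q θ s i j) := Finset.sum_comm
    _ ≤ _ := Finset.le_sup (f := fun θ => ∑ i, ∑ j, nonzeroRows (lin.Q θ s i j))
        (Finset.mem_univ θ)

end Optimal

end CodedPIRProtocol.Linear

lemma PMF.map_equiv_uniformOfFintype {α β : Type*} [Fintype α] [Nonempty α] [Fintype β]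
    [Nonempty β] (e : α ≃ β) :
    (PMF.uniformOfFintype α).map e = PMF.uniformOfFintype β := by
  classical
  ext b
  rw [PMF.map_apply, tsum_eq_single (e.symm b)]
  · simp [PMF.uniformOfFintype_apply, Fintype.card_congr e]
  · intro a ha
    rw [if_neg]
    rintro rfl
    simp at ha

/-! ### Zero-padded rows and cyclic shifts -/

section Padding

variable {F : Type u} [Field F] {p r m : ℕ}

/-- A row of `p` blocks of length `m`, extended by `r` zero blocks. -/
def padded (p r m : ℕ) : (Fin (p * m) → F) →ₗ[F] (ZMod (p + r) → Fin m → F) where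
  toFun x z u := if h : z.val < p then x (finProdFinEquiv (⟨z.val, h⟩, u)) else 0
  map_add' x y := by
    ext z u
    by_cases h : z.val < p <;> simp [h]
  map_smul' a x := by
    ext z u
    by_cases h : z.val < p <;> simp [h]

lemma padded_apply (x : Fin (p * m) → F) (z : ZMod (p + r)) (u : Fin m) :
    padded p r m x z u = if h : z.val < p then x (finProdFinEquiv (⟨z.val, h⟩, u)) else 0 := rfl

lemma padded_eq_zero (x : Fin (p * m) → F) {z : ZMod (p + r)} (hz : p ≤ z.val) :
    padded p r m x z = 0 := by
  ext u
  simp [padded_apply, hz.not_gt]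

lemma padded_injective : Function.Injective (padded (F := F) p r m) := by
  rw [← LinearMap.ker_eq_bot, LinearMap.ker_eq_bot']
  intro x hx
  ext l
  obtain ⟨⟨c, u⟩, rfl⟩ := finProdFinEquiv.surjective l
  have h := congrFun (congrFun hx (c.val : ZMod (p + r))) u
  have hc : ((c.val : ZMod (p + r))).val = c.val := ZMod.val_natCast_of_lt (by omega)
  rw [padded_apply, dif_pos (by rw [hc]; exact c.2)] at h
  simpa [hc] using h

lemma padded_vecMul {K : ℕ} (v : Fin K → F) (X : Matrix (Fin K) (Fin (p * m)) F)
    (z : ZMod (p + r)) (u : Fin m) :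
    padded p r m (Matrix.vecMul v X) z u = ∑ k, v k * padded p r m (X k) z u := by
  rw [Matrix.vecMul_eq_sum, map_sum]
  simp [Finset.sum_apply]

variable (p r)

lemma natCast_injOn : Function.Injective fun k : Fin (p + r) => ((k : ℕ) : ZMod (p + r)) := by
  intro a b h
  have h' := congrArg ZMod.val h
  simp only [ZMod.val_natCast_of_lt a.2, ZMod.val_natCast_of_lt b.2] at h'
  exact Fin.ext h'

/-- Counts the shifts that bring a given position into the padding. It provides the servers that
reveal pure interference, and the queries for which an answer block vanishes. -/
lemma le_card_padding [NeZero (p + r)] (x : ZMod (p + r)) :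
    r ≤ (Finset.univ.filter fun z : ZMod (p + r) => p ≤ (z + x).val).card := by
  calc r = (Finset.univ.image fun k : Fin r => (((Fin.natAdd p k : Fin (p + r)) : ℕ) :
        ZMod (p + r)) - x).card := by
        rw [Finset.card_image_of_injective, Finset.card_univ, Fintype.card_fin]
        intro a b h
        have := natCast_injOn p r (sub_left_injective h)
        simpa using this
    _ ≤ _ := by
        refine Finset.card_le_card fun z hz => ?_
        obtain ⟨k, -, rfl⟩ := Finset.mem_image.1 hz
        rw [Finset.mem_filter, sub_add_cancel, ZMod.val_natCast_of_lt (Fin.natAdd p k).2]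
        exact ⟨Finset.mem_univ _, by simp⟩

/-- Counts the shifts whose window of length `r` reaches the block `y`; it provides the servers from
which that block of the wanted record is recovered. -/
lemma le_card_window [NeZero (p + r)] (x y : ZMod (p + r)) :
    r ≤ (Finset.univ.filter fun z : ZMod (p + r) => ∃ t : Fin r, x + z + (t : ℕ) = y).card := by
  calc r = (Finset.univ.image fun k : Fin r => y - x - (((Fin.castAdd p k).cast (add_comm r p) :
        Fin (p + r)) : ℕ)).card := by
        rw [Finset.card_image_of_injective, Finset.card_univ, Fintype.card_fin]
        intro a b h
        have := natCast_injOn p r (sub_right_injective h)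
        simpa using this
    _ ≤ _ := by
        refine Finset.card_le_card fun z hz => ?_
        obtain ⟨k, -, rfl⟩ := Finset.mem_image.1 hz
        rw [Finset.mem_filter]
        refine ⟨Finset.mem_univ _, k, ?_⟩
        simp only [Fin.val_cast, Fin.val_castAdd]
        ring

end Padding

lemma card_filter_snd {N g : ℕ} {Z : Type*} [Fintype Z] (e : Fin N ≃ Fin g × Z) (S : Z → Prop)
    [DecidablePred S] :
    (Finset.univ.filter fun i => S (e i).2).card = g * (Finset.univ.filter S).card := by
  rw [← Finset.card_map e.toEmbedding]
  have : (Finset.univ.filter fun i => S (e i).2).map e.toEmbedding =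
      Finset.univ ×ˢ Finset.univ.filter S := by
    ext x
    simp only [Finset.mem_map, Finset.mem_filter, Finset.mem_univ, true_and, Finset.mem_product]
    exact ⟨fun ⟨i, hi, h⟩ => h ▸ hi, fun hx => ⟨e.symm x, by simpa using hx, by simp⟩⟩
  rw [this, Finset.card_product, Finset.card_univ, Fintype.card_fin]

/-! ### A cyclic scheme whose rate approaches the capacity -/

section CyclicScheme

variable {F : Type u} [Field F] [Fintype F] [DecidableEq F] {K N M : ℕ}
  (G : Matrix (Fin K) (Fin N) F)

/-- The protocol in which the user picks a uniformly random shift for every record, and the shift of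
the wanted record is displaced by `σ i` for server `i`. Server `i` answers, for each `t < r`, with
the sum over the records of the block at position `t` plus the shift in the padded row. -/
def cyclicProtocol (M : ℕ) {p r m : ℕ} [NeZero (p + r)] (hp : 0 < p) (hm : 0 < m)
    (σ : Fin N → ZMod (p + r)) : CodedPIRProtocol F M G where
  cols := p * m
  cols_pos := Nat.mul_pos hp hm
  Seed := ULift (Fin M → ZMod (p + r))
  seedLaw := PMF.uniformOfFintype _
  Query _ := ULift (Fin M → ZMod (p + r))
  query θ s i := ⟨s.down + Pi.single θ (σ i)⟩
  Answer _ := Fin r → Fin m → F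
  answerFintype _ := inferInstance
  ans _ q c t u := ∑ j, padded p r m (c j) (q.down j + (t : ℕ)) u

variable {p r m : ℕ} [NeZero (p + r)] (hp : 0 < p) (hm : 0 < m) (σ : Fin N → ZMod (p + r))

omit [DecidableEq F] in
-- Displacing a uniform shift by a constant leaves it uniform, which is the whole reason for
-- privacy.
lemma cyclicProtocol_map_query (θ : Fin M) (i : Fin N) :
    (cyclicProtocol G M hp hm σ).seedLaw.map
      (fun s => (cyclicProtocol G M hp hm σ).query θ s i) =
      PMF.uniformOfFintype (ULift.{u} (Fin M → ZMod (p + r))) :=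
  PMF.map_equiv_uniformOfFintype
    ((Equiv.ulift.trans (Equiv.addRight (Pi.single θ (σ i) : Fin M → ZMod (p + r)))).trans Equiv.ulift.symm)

omit [DecidableEq F] in
lemma cyclicProtocol_map_jointLaw (θ : Fin M) (i : Fin N) {α : Type*}
    (f : ULift.{u} (Fin M → ZMod (p + r)) → (cyclicProtocol G M hp hm σ).Records → α) :
    (cyclicProtocol G M hp hm σ).jointLaw.map
      (fun x => f ((cyclicProtocol G M hp hm σ).query θ x.2 i) x.1) =
      (PMF.uniformOfFintype (ULift.{u} (Fin M → ZMod (p + r)))).bind fun q =>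
        (PMF.uniformOfFintype _).map (f q) := by
  refine (CodedPIRProtocol.map_jointLaw _ _).trans ?_
  rw [← cyclicProtocol_map_query G hp hm σ θ i]
  exact (PMF.bind_map (cyclicProtocol G M hp hm σ).seedLaw
    (fun s => (cyclicProtocol G M hp hm σ).query θ s i)
    fun q => (PMF.uniformOfFintype _).map (f q)).symm

omit [DecidableEq F] in
lemma cyclicProtocol_isPrivate : (cyclicProtocol G M hp hm σ).IsPrivate := by
  intro i θ θ'
  exact (cyclicProtocol_map_jointLaw G hp hm σ θ i fun q W =>
    (q, (cyclicProtocol G M hp hm σ).ans i q ((cyclicProtocol G M hp hm σ).stored i W),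
      (cyclicProtocol G M hp hm σ).stored i W)).trans
    (cyclicProtocol_map_jointLaw G hp hm σ θ' i fun q W =>
    (q, (cyclicProtocol G M hp hm σ).ans i q ((cyclicProtocol G M hp hm σ).stored i W),
      (cyclicProtocol G M hp hm σ).stored i W)).symm

variable {G}

/-- For fixed `t` the interference, as the server varies, is a codeword. At `g * r = K` servers the
wanted record contributes only padding, so these determine the codeword. Once it is removed, each
block of the wanted record is seen by `g * r = K` servers and is likewise determined. The argument
is run on the difference of two choices of records with equal answers. -/
lemma cyclicProtocol_eq_of_answer_eq (hG : IsMDSGenerator G) {g : ℕ} (hK : K = g * r)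
    (e : Fin N ≃ Fin g × ZMod (p + r)) (θ : Fin M)
    (W W' : Fin M → Matrix (Fin K) (Fin (p * m)) F)
    (s : ULift.{u} (Fin M → ZMod (p + r)))
    (h : ∀ i, (cyclicProtocol G M hp hm fun i => (e i).2).answer θ i W s =
      (cyclicProtocol G M hp hm fun i => (e i).2).answer θ i W' s) : W θ = W' θ := by
  obtain ⟨b⟩ := s
  let V : Fin M → Fin K → Fin (p * m) → F := fun j k => W j k - W' j k
  let I : Fin r → Fin m → Fin K → F := fun t u k =>
    ∑ j ∈ Finset.univ.erase θ, padded p r m (V j k) (b j + (t : ℕ)) u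
  let D : ZMod (p + r) → Fin m → Fin K → F := fun z u k => padded p r m (V θ k) z u
  have key : ∀ i (t : Fin r) u, Matrix.vecMul (D (b θ + (e i).2 + (t : ℕ)) u) G i +
      Matrix.vecMul (I t u) G i = 0 := by
    intro i t u
    have hi := congrFun (congrFun (h i) t) u
    change ∑ j, padded p r m (Matrix.vecMul (G.col i) (W j))
      ((b + Pi.single θ (e i).2 : Fin M → ZMod (p + r)) j + (t : ℕ)) u =
      ∑ j, padded p r m (Matrix.vecMul (G.col i) (W' j))
        ((b + Pi.single θ (e i).2 : Fin M → ZMod (p + r)) j + (t : ℕ)) u at hi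
    rw [← sub_eq_zero, ← Finset.sum_sub_distrib] at hi
    have hterm : ∀ j z, padded p r m (Matrix.vecMul (G.col i) (W j)) z u -
        padded p r m (Matrix.vecMul (G.col i) (W' j)) z u =
        ∑ k, G k i * padded p r m (V j k) z u := by
      intro j z
      simp only [V, padded_vecMul, map_sub, Pi.sub_apply, mul_sub, Finset.sum_sub_distrib]
      rfl
    simp only [hterm] at hi
    rw [← Finset.add_sum_erase _ _ (Finset.mem_univ θ)] at hi
    rw [← hi]
    congr 1
    · simp only [Matrix.vecMul, dotProduct, D, Pi.add_apply, Pi.single_eq_same]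
      exact Finset.sum_congr rfl fun k _ => mul_comm _ _
    · simp only [Matrix.vecMul, dotProduct, I, Finset.sum_mul]
      rw [Finset.sum_comm]
      refine Finset.sum_congr rfl fun j hj => Finset.sum_congr rfl fun k _ => ?_
      rw [Pi.add_apply, Pi.single_eq_of_ne (Finset.ne_of_mem_erase hj), add_zero, mul_comm]
  have hI : ∀ t u, I t u = 0 := by
    intro t u
    refine hG.eq_zero (s := Finset.univ.filter fun i => p ≤ ((e i).2 + (b θ + (t : ℕ))).val) ?_ ?_
    · rw [card_filter_snd e fun z => p ≤ (z + (b θ + (t : ℕ))).val]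
      exact hK.le.trans (Nat.mul_le_mul_left g (le_card_padding p r _))
    · intro i hi
      have hz : D (b θ + (e i).2 + (t : ℕ)) u = 0 := by
        funext k
        simp only [D]
        rw [padded_eq_zero]
        · rfl
        · rw [add_comm (b θ), add_assoc]
          exact (Finset.mem_filter.1 hi).2
      simpa [hz] using key i t u
  have hDz : ∀ z u, D z u = 0 := by
    intro z u
    classical
    refine hG.eq_zero
      (s := Finset.univ.filter fun i => ∃ t : Fin r, b θ + (e i).2 + (t : ℕ) = z) ?_ ?_
    · rw [card_filter_snd e fun x => ∃ t : Fin r, b θ + x + (t : ℕ) = z]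
      exact hK.le.trans (Nat.mul_le_mul_left g (le_card_window p r _ _))
    · intro i hi
      obtain ⟨t, rfl⟩ := (Finset.mem_filter.1 hi).2
      simpa [hI] using key i t u
  funext k
  have hV : padded p r m (V θ k) = 0 :=
    funext fun z => funext fun u => congrFun (hDz z u) k
  exact sub_eq_zero.1 ((map_eq_zero_iff _ padded_injective).1 hV)

lemma cyclicProtocol_isCorrect (hG : IsMDSGenerator G) {g : ℕ} (hK : K = g * r)
    (e : Fin N ≃ Fin g × ZMod (p + r)) :
    (cyclicProtocol G M hp hm fun i => (e i).2).IsCorrect := by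
  classical
  intro θ
  let P := cyclicProtocol G M hp hm fun i => (e i).2
  refine ⟨fun a _ s => if h : ∃ W : P.Records, ∀ i, P.answer θ i W s = a i then h.choose θ else 0,
    fun W s _ => ?_⟩
  have hex : ∃ W' : P.Records, ∀ i, P.answer θ i W' s = P.answer θ i W s := ⟨W, fun _ => rfl⟩
  refine (dif_pos hex).trans ?_
  exact cyclicProtocol_eq_of_answer_eq hp hm hG hK e θ _ W s hex.choose_spec

omit [DecidableEq F] in
-- The first term is the entropy of the query, which does not grow with the block length `m`. The
-- second is the mean number of answer blocks that are not forced to be zero: a block is forced to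
-- be zero when all `M` shifts land in the padding, with probability at least `(r / (p + r)) ^ M`.
lemma cyclicProtocol_entropy_answer_le (θ : Fin M) (i : Fin N) :
    ((cyclicProtocol G M hp hm σ).jointLaw.map fun x =>
      (cyclicProtocol G M hp hm σ).answer θ i x.1 x.2).entropy ≤
      M * log (p + r : ℕ) +
        m * (r * (1 - ((r : ℝ) / (p + r : ℕ)) ^ M)) * log (Fintype.card F) := by
  classical
  let P := cyclicProtocol G M hp hm σ
  let Z := ULift.{u} (Fin M → ZMod (p + r))
  have hn : (0 : ℝ) < ((p + r : ℕ) : ℝ) := by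
    exact_mod_cast Nat.pos_of_ne_zero (NeZero.ne (p + r))
  have hlaw : (P.jointLaw.map fun x => P.answer θ i x.1 x.2) =
      (PMF.uniformOfFintype Z).bind fun q => (PMF.uniformOfFintype P.Records).map fun W =>
        P.ans i q (P.stored i W) :=
    cyclicProtocol_map_jointLaw G hp hm σ θ i fun q W => P.ans i q (P.stored i W)
  have hcardZ : Fintype.card Z = (p + r) ^ M := by
    simp [Z, ZMod.card]
  let null : Z → Fin r → Prop := fun q t => ∀ j, p ≤ (q.down j + (t : ℕ)).val
  have hcomp : ∀ q : Z, ((PMF.uniformOfFintype P.Records).map fun W =>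
      P.ans i q (P.stored i W)).entropy ≤
      (Finset.univ.filter fun t => ¬ null q t).card * (m * log (Fintype.card F)) := by
    intro q
    refine (PMF.entropy_le_log_card _ (Fintype.piFinset fun t : Fin r =>
      if null q t then {(0 : Fin m → F)} else Finset.univ) ?_).trans (le_of_eq ?_)
    · intro a ha
      obtain ⟨W, -, rfl⟩ := (PMF.mem_support_map_iff _ _ _).1 ha
      refine Fintype.mem_piFinset.2 fun t => ?_
      split_ifs with h
      · rw [Finset.mem_singleton]
        funext u
        change ∑ j, padded p r m (P.stored i W j) (q.down j + (t : ℕ)) u = 0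
        exact Finset.sum_eq_zero fun j _ => congrFun (padded_eq_zero _ (h j)) u
      · exact Finset.mem_univ _
    · rw [Fintype.card_piFinset]
      have : ∀ t, (if null q t then {(0 : Fin m → F)} else Finset.univ).card =
          if ¬ null q t then Fintype.card F ^ m else 1 := by
        intro t
        split_ifs <;> simp_all
      simp_rw [this]
      rw [← Finset.prod_filter, Finset.prod_const]
      push_cast
      rw [log_pow, log_pow]
  have hcount : ∑ q : Z, ((Finset.univ.filter fun t => ¬ null q t).card : ℝ) ≤
      r * (((p + r : ℕ) : ℝ) ^ M - (r : ℝ) ^ M) := by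
    have hnull : ∀ t, (r : ℝ) ^ M ≤ ((Finset.univ.filter fun q : Z => null q t).card : ℝ) := by
      intro t
      have h1 : r ^ M ≤ (Fintype.piFinset fun _ : Fin M =>
          Finset.univ.filter fun z : ZMod (p + r) => p ≤ (z + ((t : ℕ) : ZMod (p + r))).val).card := by
        rw [Fintype.card_piFinset, Finset.prod_const, Finset.card_univ, Fintype.card_fin]
        exact Nat.pow_le_pow_left (le_card_padding p r _) M
      have h2 : (Fintype.piFinset fun _ : Fin M => Finset.univ.filter fun z : ZMod (p + r) =>
          p ≤ (z + ((t : ℕ) : ZMod (p + r))).val).card ≤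
          (Finset.univ.filter fun q : Z => null q t).card := by
        refine Finset.card_le_card_of_injOn (fun b => ⟨b⟩) (fun b hb => ?_)
          (fun b _ b' _ h => congrArg ULift.down h)
        have hb' := Fintype.mem_piFinset.1 hb
        simp only [Finset.coe_filter, Finset.mem_univ, true_and, Set.mem_ofPred_eq]
        exact fun j => (Finset.mem_filter.1 (hb' j)).2
      exact_mod_cast h1.trans h2
    have hnot : ∀ t, ((Finset.univ.filter fun q : Z => ¬ null q t).card : ℝ) ≤
        ((p + r : ℕ) : ℝ) ^ M - (r : ℝ) ^ M := by
      intro t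
      have h := Finset.card_filter_add_card_filter_not (s := (Finset.univ : Finset Z))
        (fun q => null q t)
      rw [Finset.card_univ, hcardZ] at h
      have h' := congrArg (Nat.cast (R := ℝ)) h
      push_cast at h' ⊢
      linarith [hnull t]
    have hswap : ∑ q : Z, ((Finset.univ.filter fun t => ¬ null q t).card : ℝ) =
        ∑ t, ((Finset.univ.filter fun q : Z => ¬ null q t).card : ℝ) := by
      simp_rw [Finset.card_filter, Nat.cast_sum]
      rw [Finset.sum_comm]
    rw [hswap]
    refine (Finset.sum_le_sum fun t _ => hnot t).trans (le_of_eq ?_)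
    rw [Finset.sum_const, Finset.card_univ, Fintype.card_fin, nsmul_eq_mul]
  have hq := CodedPIRProtocol.log_card_pos F
  change (P.jointLaw.map fun x => P.answer θ i x.1 x.2).entropy ≤ _
  rw [hlaw]
  refine (PMF.entropy_bind_le _ _).trans (add_le_add (le_of_eq ?_) ?_)
  · rw [PMF.entropy_uniformOfFintype, hcardZ, Nat.cast_pow, log_pow]
  · calc _ ≤ ∑ q : Z, (((p + r : ℕ) : ℝ) ^ M)⁻¹ *
          ((Finset.univ.filter fun t => ¬ null q t).card * (m * log (Fintype.card F))) := by
          refine Finset.sum_le_sum fun q _ => ?_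
          rw [PMF.uniformOfFintype_apply, hcardZ]
          simp only [ENNReal.toReal_inv, Nat.cast_pow]
          exact mul_le_mul_of_nonneg_left (hcomp q) (by positivity)
      _ = (((p + r : ℕ) : ℝ) ^ M)⁻¹ * (m * log (Fintype.card F)) *
          ∑ q : Z, ((Finset.univ.filter fun t => ¬ null q t).card : ℝ) := by
          rw [Finset.mul_sum]
          exact Finset.sum_congr rfl fun q _ => by ring
      _ ≤ (((p + r : ℕ) : ℝ) ^ M)⁻¹ * (m * log (Fintype.card F)) *
          (r * (((p + r : ℕ) : ℝ) ^ M - (r : ℝ) ^ M)) :=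
          mul_le_mul_of_nonneg_left hcount (by positivity)
      _ = _ := by
          rw [div_pow]
          field_simp

end CyclicScheme

/-! ### Lower bound for the capacity -/

section Capacity

variable {F : Type u} [Field F] [Fintype F] [DecidableEq F] {K N M : ℕ}
  {G : Matrix (Fin K) (Fin N) F}

lemma CodedPIRScheme.downloadSize_pos (hK : 0 < K) (P : CodedPIRScheme F M G) (θ : Fin M) :
    0 < P.downloadSize θ :=
  lt_of_lt_of_le (by exact_mod_cast Nat.mul_pos hK P.cols_pos) (P.correct.le_downloadSize θ)

/-- A crude bound is enough: it makes the set of rates bounded above, so that its real supremum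
dominates every rate. -/
lemma CodedPIRScheme.rate_le_one (hK : 0 < K) (P : CodedPIRScheme F M G) (θ : Fin M) :
    P.rate θ ≤ 1 :=
  (div_le_one (P.downloadSize_pos hK θ)).2 (P.correct.le_downloadSize θ)

lemma CodedPIRScheme.rate_le_capacity (hK : 0 < K) (P : CodedPIRScheme F M G) (θ : Fin M) :
    P.rate θ ≤ codedPIRCapacity M G :=
  le_csSup ⟨1, by rintro _ ⟨P, θ, rfl⟩; exact P.rate_le_one hK θ⟩ ⟨P, θ, rfl⟩

/-- The capacity is at least `(1 + ρ + ⋯ + ρ ^ (M - 1))⁻¹` with `ρ = K / N`. -/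
theorem one_le_capacity_mul_rateSum (hG : IsMDSGenerator G) (hK : 0 < K) (hKN : K < N)
    (hM : 0 < M) : 1 ≤ codedPIRCapacity M G * rateSum K N M := by
  let θ : Fin M := ⟨0, hM⟩
  -- With `g = gcd N K`, a padded row has `n = p + r = N / g` blocks, of which `r = K / g` are zero.
  obtain ⟨g, r, p, hKg, hNg, hp⟩ : ∃ g r p, K = g * r ∧ N = g * (p + r) ∧ 0 < p := by
    obtain ⟨r, hr⟩ := Nat.gcd_dvd_right N K
    obtain ⟨n, hn⟩ := Nat.gcd_dvd_left N K
    have hlt : r < n := by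
      have : N.gcd K * r < N.gcd K * n := by rw [← hr, ← hn]; exact hKN
      exact lt_of_mul_lt_mul_left this (Nat.zero_le _)
    exact ⟨N.gcd K, r, n - r, hr, by rw [Nat.sub_add_cancel hlt.le]; exact hn, by omega⟩
  have : NeZero (p + r) := ⟨by omega⟩
  have e : Fin N ≃ Fin g × ZMod (p + r) :=
    Fintype.equivOfCardEq (by simp [hNg, ZMod.card])
  have hq := CodedPIRProtocol.log_card_pos F
  have hKr : (0 : ℝ) < K := by exact_mod_cast hK
  have hNr : (0 : ℝ) < N := by exact_mod_cast hK.trans hKN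
  have hpr : (0 : ℝ) < p := by exact_mod_cast hp
  have hnr : (0 : ℝ) < ((p + r : ℕ) : ℝ) := by exact_mod_cast (by omega : 0 < p + r)
  have hgr : (0 : ℝ) < g := by
    refine (Nat.cast_nonneg g).lt_of_ne fun h => ?_
    rw [hNg, Nat.cast_mul, ← h, zero_mul] at hNr
    exact lt_irrefl _ hNr
  have hρ : (K : ℝ) / N = (r : ℝ) / (p + r : ℕ) := by
    rw [hKg, hNg, Nat.cast_mul, Nat.cast_mul, mul_div_mul_left _ _ hgr.ne']
  set cap := codedPIRCapacity M G with hcap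
  set B : ℝ := N * (M * log (p + r : ℕ)) / log (Fintype.card F) with hB
  set A : ℝ := N * (r * (1 - ((r : ℝ) / (p + r : ℕ)) ^ M)) with hA
  -- `B + m * A` bounds the download for blocks of length `m`. The cost `B` of unconditioned answers
  -- is independent of `m` and disappears as `m` grows.
  have hmain : ∀ m : ℕ, 0 < m → 0 ≤ cap ∧ (K : ℝ) * p * m ≤ cap * (B + m * A) := by
    intro m hm
    let P : CodedPIRScheme F M G :=
      { cyclicProtocol G M hp hm fun i => (e i).2 with
        correct := cyclicProtocol_isCorrect hp hm hG hKg e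
        priv := cyclicProtocol_isPrivate G hp hm fun i => (e i).2 }
    have hrate := P.rate_le_capacity hK θ
    have hpos := P.downloadSize_pos hK θ
    have hD : P.downloadSize θ ≤ B + m * A := by
      have h : P.downloadSize θ ≤ ∑ _i : Fin N, (M * log (p + r : ℕ) +
          m * (r * (1 - ((r : ℝ) / (p + r : ℕ)) ^ M)) * log (Fintype.card F)) /
          log (Fintype.card F) := by
        refine Finset.sum_le_sum fun i _ => ?_
        rw [CodedPIRProtocol.entropyBase_eq]
        exact div_le_div_of_nonneg_right
          (cyclicProtocol_entropy_answer_le hp hm (fun i => (e i).2) θ i) hq.le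
      refine h.trans (le_of_eq ?_)
      rw [Finset.sum_const, Finset.card_univ, Fintype.card_fin, nsmul_eq_mul, hA, hB]
      field_simp
    have hL : (K : ℝ) * p * m = ((K * P.cols : ℕ) : ℝ) := by
      change _ = ((K * (p * m) : ℕ) : ℝ)
      push_cast
      ring
    have hcap0 : 0 ≤ cap := le_trans (div_nonneg (Nat.cast_nonneg _) hpos.le) hrate
    refine ⟨hcap0, ?_⟩
    rw [hL]
    exact ((div_le_iff₀ hpos).1 hrate).trans (mul_le_mul_of_nonneg_left hD hcap0)
  have hlim : (K : ℝ) * p ≤ cap * A := by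
    by_contra! hlt
    obtain ⟨m, hm⟩ := exists_nat_gt (cap * B / (K * p - cap * A))
    rw [div_lt_iff₀ (by linarith)] at hm
    have h := (hmain (m + 1) (Nat.succ_pos m)).2
    push_cast at h
    linarith
  have hgeom : rateSum K N M * (1 - (r : ℝ) / (p + r : ℕ)) = 1 - ((r : ℝ) / (p + r : ℕ)) ^ M := by
    rw [rateSum, hρ]
    exact geom_sum_mul_neg _ _
  have hA' : A = K * p * rateSum K N M := by
    rw [hA, ← hgeom, hKg, hNg]
    push_cast at hnr ⊢
    field_simp
    ring
  rw [hA'] at hlim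
  refine le_of_mul_le_mul_left ?_ (mul_pos hKr hpr)
  linarith

lemma CodedPIRScheme.CapacityAchieving.downloadSize_le {P : CodedPIRScheme F M G}
    (hP : P.CapacityAchieving) (hG : IsMDSGenerator G) (hK : 0 < K) (hKN : K < N) (θ : Fin M) :
    P.downloadSize θ ≤ (K * P.cols : ℕ) * rateSum K N M := by
  have hpos := P.downloadSize_pos hK θ
  have h1 := one_le_capacity_mul_rateSum hG hK hKN θ.pos
  rw [← hP θ, CodedPIRProtocol.rate, div_mul_eq_mul_div, le_div_iff₀ hpos, one_mul] at h1
  exact h1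

end Capacity

end

theorem theorem3 {F : Type*} [Field F] [Fintype F] [DecidableEq F] {K N M : ℕ}
    (hM : 2 ≤ M) (hKN : K < N)
    (G : Matrix (Fin K) (Fin N) F) (hG : IsMDSGenerator G)
    (P : CodedPIRScheme F M G) (lin : P.Linear) (hP : P.CapacityAchieving) :
    ∀ s ∈ P.seedLaw.support, M * K * (N / Nat.gcd N K) ^ (M - 1) ≤ lin.accessNumber s := by
  intro s hs
  rcases Nat.eq_zero_or_pos K with rfl | hK
  · simp
  · exact CodedPIRProtocol.Linear.le_accessNumber lin hG hK hKN P.correct P.priv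
      (hP.downloadSize_le hG hK hKN) hM hs
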